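/- All graphs are finite, undirected and simple; $d(x)$ is the degree of a vertex $x$, $\lambda_{\min}(G)$ is the smallest eigenvalue of the adjacency matrix of $G$, and a graph is $\mu$-bounded with parameter $c$ if any two distinct non-adjacent vertices have at most $c$ common neighbors. A Hoffman graph is a graph whose vertices are labeled fat or slim, such that no two fat vertices are adjacent and every fat vertex has a slim neighbor. Its slim graph is the subgraph induced by the slim vertices, and it is $t$-fat if every slim vertex has at least $t$ fat neighbors. Induced Hoffman subgraphs and isomorphisms are those of graphs, respecting the labels. The special matrix of a Hoffman graph $\mathfrak h$ is $S(\mathfrak h)=A_{\rm slim}-D^TD$, where $A_{\rm slim}$ is the adjacency matrix of its slim graph and $D$ is the fat-by-slim $0/1$ adjacency block. A decomposition of $\mathfrak h$ is given by a partition $V_1,\dots,V_r$ of its slim vertices such that $S(\mathfrak h)$ is block diagonal with respect to this partition, with diagonal blocks $S(\mathfrak h^1),\dots,S(\mathfrak h^r)$, where the member $\mathfrak h^i$ is the induced Hoffman subgraph on $V_i$ and all fat vertices having a neighbor in $V_i$. For a family $\mathfrak G$ of Hoffman graphs, $\mathfrak h$ is a $\mathfrak G$-line Hoffman graph if there is a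 Hoffman graph $\mathfrak h'$ that contains $\mathfrak h$ as an induced Hoffman subgraph, has the same slim graph as $\mathfrak h$, and has a decomposition each of whose members is isomorphic to an induced Hoffman subgraph of a member of $\mathfrak G$. For $q\ge 2$, the associated Hoffman graph $\mathfrak g(G,q)$ has slim graph $G$ and one fat vertex for each maximal clique of $G$ with at least $q$ vertices, that fat vertex being adjacent precisely to the vertices of the clique. Let $\mathfrak h^{(3)}$ be the Hoffman graph with one slim vertex adjacent to three fat vertices, and let $\mathfrak k$ be the Hoffman graph with two adjacent slim vertices and two fat vertices in which each slim vertex is adjacent to both fat vertices. **Theorem.** Let $c\ge 1$ be an integer, $\tilde c=\min\{c,6\}$, $q=\max\{c+5,\,50\tilde c+16\}$ and $K=\max\{36c+400\tilde c+83,\,44c-5\}$. Suppose that a graph $G$ satisfies the following conditions: 1. $G$ is $\mu$-bounded with parameter $c$; 2. every (nonempty) clique $C$ of $G$ has order at most $\min_{x\in C}d(x)-K$; 3. $\lambda_{\min}(G)\ge -3$. Then the associated Hoffman graph $\mathfrak g(G,q)$ is a $2$-fat $\{\mathfrak h^{(3)},\mathfrak k\}$-line Hoffman graph. -/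

import Mathlib

universe u w

/-- A graph is `μ`-bounded with parameter `c` if any two distinct non-adjacent vertices have at
most `c` common neighbours. -/
def IsMuBounded {V : Type u} (G : SimpleGraph V) (c : ℕ) : Prop :=
  ∀ x y : V, x ≠ y → ¬ G.Adj x y → (G.commonNeighbors x y).ncard ≤ c

/-- `λ_min(G) ≥ a`: every eigenvalue of the adjacency matrix of the finite graph `G` is at least
`a`. (The matrix is real symmetric, so all its eigenvalues are real.) -/
def SmallestEigenvalueGE {V : Type u} [Fintype V] [DecidableEq V] (G : SimpleGraph V)
    [DecidableRel G.Adj] (a : ℝ) : Prop :=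
  ∀ θ : ℝ, Module.End.HasEigenvalue (Matrix.toLin' (G.adjMatrix ℝ)) θ → a ≤ θ

/-- A Hoffman graph with vertex set `V`: a graph together with a labelling of its vertices as
fat (those in `fat`) or slim (all others), such that no two fat vertices are adjacent and every
fat vertex has at least one slim neighbour. -/
structure HoffmanGraph (V : Type u) where
  graph : SimpleGraph V
  fat : Set V
  fat_not_adj : ∀ x ∈ fat, ∀ y ∈ fat, ¬ graph.Adj x y
  exists_slim_adj : ∀ f ∈ fat, ∃ x, x ∉ fat ∧ graph.Adj f x

namespace HoffmanGraph

variable {V : Type u}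

/-- The set of slim vertices. -/
def slim (h : HoffmanGraph V) : Set V := h.fatᶜ

/-- The slim graph: the subgraph induced by the slim vertices. -/
def slimGraph (h : HoffmanGraph V) : SimpleGraph h.slim := h.graph.induce h.slim

/-- The set of fat neighbours of a vertex. -/
def fatNeighbors (h : HoffmanGraph V) (x : V) : Set V := {f | f ∈ h.fat ∧ h.graph.Adj x f}

/-- A (finite) Hoffman graph is `t`-fat if every slim vertex has at least `t` fat neighbours. -/
def IsTFat (h : HoffmanGraph V) (t : ℕ) : Prop :=
  ∀ x ∈ h.slim, t ≤ (h.fatNeighbors x).ncard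

/-- An embedding of `h₁` onto an induced Hoffman subgraph of `h₂`: an isomorphism from the graph
of `h₁` onto an induced subgraph of the graph of `h₂` which preserves the labels. -/
structure InducedEmbedding {V₁ : Type u} {V₂ : Type w} (h₁ : HoffmanGraph V₁)
    (h₂ : HoffmanGraph V₂) where
  toEmbedding : h₁.graph ↪g h₂.graph
  mem_fat_iff : ∀ x : V₁, toEmbedding x ∈ h₂.fat ↔ x ∈ h₁.fat

open Classical in
/-- The block `D` of the adjacency matrix: rows are the fat vertices, columns the slim ones. -/
noncomputable def fatSlimMatrix (h : HoffmanGraph V) : Matrix h.fat h.slim ℤ :=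
  Matrix.of fun f x => if h.graph.Adj (f : V) (x : V) then 1 else 0

open Classical in
/-- The special matrix `S(h) = A_slim - Dᵀ D`. -/
noncomputable def specialMatrix [Finite V] (h : HoffmanGraph V) : Matrix h.slim h.slim ℤ :=
  letI : Fintype h.fat := Fintype.ofFinite _
  h.slimGraph.adjMatrix ℤ - h.fatSlimMatrix.transpose * h.fatSlimMatrix

/-- The vertex set of the induced Hoffman subgraph generated by a set `W` of slim vertices:
`W` together with all fat vertices having a neighbour in `W`. -/
def generatedSet (h : HoffmanGraph V) (W : Set V) : Set V :=
  W ∪ {f | f ∈ h.fat ∧ ∃ w ∈ W, h.graph.Adj f w}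

/-- The induced Hoffman subgraph of `h` generated by a set `W` of slim vertices. -/
def generated (h : HoffmanGraph V) (W : Set V) (hW : W ⊆ h.slim) :
    HoffmanGraph (h.generatedSet W) where
  graph := h.graph.induce (h.generatedSet W)
  fat := {x | (x : V) ∈ h.fat}
  fat_not_adj := fun x hx y hy => h.fat_not_adj x hx y hy
  exists_slim_adj := by
    rintro ⟨f, hf⟩ hfat
    rcases hf with hf | ⟨_, v, hv, hadj⟩
    · exact absurd hfat (hW hf)
    · exact ⟨⟨v, Or.inl hv⟩, hW hv, hadj⟩

/-- A decomposition of `h` with `r` members: a partition of the slim vertices into `r` nonempty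
parts such that the special matrix of `h` is, with respect to this partition, the block diagonal
matrix whose blocks are the special matrices of the induced Hoffman subgraphs generated by the
parts. The members of the decomposition are these generated subgraphs (`block`). -/
structure Decomposition [Finite V] (h : HoffmanGraph V) (r : ℕ) where
  part : Fin r → Set V
  part_subset : ∀ i, part i ⊆ h.slim
  part_nonempty : ∀ i, (part i).Nonempty
  part_disjoint : ∀ i j, i ≠ j → Disjoint (part i) (part j)
  part_cover : ∀ x ∈ h.slim, ∃ i, x ∈ part i
  special_eq :
    h.specialMatrix.submatrix
        (fun p : (i : Fin r) × (h.generated (part i) (part_subset i)).slim =>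
          (⟨p.2.1.1, p.2.2⟩ : h.slim))
        (fun p : (i : Fin r) × (h.generated (part i) (part_subset i)).slim =>
          (⟨p.2.1.1, p.2.2⟩ : h.slim)) =
      Matrix.blockDiagonal' fun i => (h.generated (part i) (part_subset i)).specialMatrix

/-- The `i`-th member of a decomposition. -/
def Decomposition.block [Finite V] {h : HoffmanGraph V} {r : ℕ} (d : h.Decomposition r)
    (i : Fin r) : HoffmanGraph (h.generatedSet (d.part i)) :=
  h.generated (d.part i) (d.part_subset i)

/-- `h` is an `𝔊`-line Hoffman graph: there is a finite Hoffman graph `h'` containing `h` as an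
induced Hoffman subgraph, with the same slim graph as `h` (no slim vertex of `h'` lies outside
`h`), which has a decomposition all of whose members are isomorphic to induced Hoffman subgraphs
of members of `𝔊`. -/
def IsLineHoffmanGraph (𝔊 : Set ((W : Type w) × HoffmanGraph W)) (h : HoffmanGraph V) : Prop :=
  ∃ (V' : Type u) (_ : Finite V') (h' : HoffmanGraph V') (φ : InducedEmbedding h h'),
    (∀ x ∈ h'.slim, x ∈ Set.range φ.toEmbedding) ∧
    ∃ (r : ℕ) (d : h'.Decomposition r),
      ∀ i : Fin r, ∃ g ∈ 𝔊, Nonempty (InducedEmbedding (d.block i) g.2)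

/-- The Hoffman graph with `s + 1` slim vertices, which are pairwise adjacent, and `t` fat
vertices, each of which is adjacent to every slim vertex. -/
def completeJoin (s t : ℕ) : HoffmanGraph (Fin (s + 1) ⊕ Fin t) where
  graph :=
    { Adj := fun x y => x ≠ y ∧ (x.isLeft = true ∨ y.isLeft = true)
      symm := ⟨fun _ _ hxy => ⟨hxy.1.symm, hxy.2.symm⟩⟩
      loopless := ⟨fun _ hx => hx.1 rfl⟩ }
  fat := Set.range Sum.inr
  fat_not_adj := by
    rintro _ ⟨a, rfl⟩ _ ⟨b, rfl⟩ ⟨_, hab⟩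
    simp at hab
  exists_slim_adj := by
    rintro _ ⟨a, rfl⟩
    exact ⟨Sum.inl 0, by simp, by simp⟩

/-- `𝔥⁽³⁾`: one slim vertex adjacent to three fat vertices. -/
def oneSlimThreeFat : HoffmanGraph (Fin 1 ⊕ Fin 3) := completeJoin 0 3

/-- Two adjacent slim vertices, each adjacent to both of two fat vertices. -/
def twoSlimTwoFat : HoffmanGraph (Fin 2 ⊕ Fin 2) := completeJoin 1 2

end HoffmanGraph

/-- The associated Hoffman graph `𝔤(G, q)` for `q ≥ 2`: its slim graph is `G`, and it has one fat
vertex for each maximal clique of `G` with at least `q` vertices, adjacent precisely to the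
vertices of that clique. -/
def associatedHoffmanGraph {V : Type u} (G : SimpleGraph V) (q : ℕ) (hq : 2 ≤ q) :
    HoffmanGraph (V ⊕ {C : Finset V // Maximal G.IsClique (C : Set V) ∧ q ≤ C.card}) where
  graph :=
    { Adj := fun a b =>
        match a, b with
        | Sum.inl x, Sum.inl y => G.Adj x y
        | Sum.inl x, Sum.inr C => x ∈ C.1
        | Sum.inr C, Sum.inl x => x ∈ C.1
        | Sum.inr _, Sum.inr _ => False
      symm := ⟨by
        rintro (x | C) (y | D) hxy
        · exact G.symm.symm _ _ hxy
        · exact hxy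
        · exact hxy
        · exact hxy⟩
      loopless := ⟨by
        rintro (x | C) hx
        · exact G.loopless.irrefl x hx
        · exact hx⟩ }
  fat := Set.range Sum.inr
  fat_not_adj := by
    rintro _ ⟨C, rfl⟩ _ ⟨D, rfl⟩ hCD
    exact hCD
  exists_slim_adj := by
    rintro _ ⟨C, rfl⟩
    obtain ⟨x, hx⟩ : C.1.Nonempty := Finset.card_pos.mp (by have := C.2.2; omega)
    exact ⟨Sum.inl x, by simp, hx⟩

/-! Since `λ_min ≥ -3`, the matrix `A + 3I` is positive semidefinite: vertices become vectors of
square norm 3 whose products are 1 or 0 according to adjacency. Represent a big clique (maximal, at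
least `q` vertices) by the average of its vectors. An outside vertex has at most `min c 6`
neighbours in it (`card_filter_adj_le`), and `q` is so large that the averages are nearly
orthonormal, while a vertex has product about 1 with the averages of its own cliques and about 0
with the others.

Subtracting from a vertex the averages of its `k` big cliques thus leaves a residual of square norm
about `3 - k`. Hence `k ≤ 3`, while the degree condition gives `k ≥ 2` (`exists_two_isBigClique`),
which is 2-fatness.

If `k = 3`, the residual is almost zero: the three cliques cover every edge at the vertex, and no
other vertex lies in two of them. If `k = 2`, it is almost a unit vector. Between two such vertices
the residuals nearly agree across an edge in no big clique (an uncovered edge), are nearly opposite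
for twins (two common big cliques), and otherwise have product at most about 0. So uncovered edges
form disjoint cliques (`uncovered_trans`), twins form a matching (`twin_unique`), and no twin meets
an uncovered edge (`twin_not_uncovered`).

Give each clique of uncovered edges a fat vertex too. An off-diagonal entry of the special matrix is
adjacency minus the number of common cliques, so it vanishes except at twins. The parts are then the
twin pairs, with at most two fat vertices, and single vertices, with at most three: induced
subgraphs of `𝔨` and `𝔥⁽³⁾`. -/

namespace GramForm

/-! ### The positive semidefinite form of `A + 3I` -/

theorem filter_adj_of_isClique {V : Type u} [DecidableEq V] {G : SimpleGraph V}
    [DecidableRel G.Adj] {s : Finset V} (hs : G.IsClique (s : Set V)) {x : V}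
    (hx : x ∈ s) : s.filter (G.Adj x) = s.erase x := by
  ext y
  simp only [Finset.mem_filter, Finset.mem_erase]
  constructor
  · rintro ⟨h1, h2⟩
    exact ⟨h2.ne', h1⟩
  · rintro ⟨h1, h2⟩
    exact ⟨h2, hs (by simpa using hx) (by simpa using h2) h1.symm⟩

variable {V : Type u} [Fintype V] [DecidableEq V] (G : SimpleGraph V) [DecidableRel G.Adj]

/-- The bilinear form of the matrix `A + 3I`. -/
noncomputable def form : LinearMap.BilinForm ℝ (V → ℝ) :=
  Matrix.toBilin' (G.adjMatrix ℝ + (3 : ℝ) • (1 : Matrix V V ℝ))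

/-- The coordinate vector of a vertex. -/
def vtx (x : V) : V → ℝ := Pi.single x 1

/-- The indicator vector of a set of vertices. -/
def ind (s : Finset V) : V → ℝ := ∑ u ∈ s, vtx u

/-- The average of the coordinate vectors over a set of vertices. -/
noncomputable def avg (s : Finset V) : V → ℝ := (s.card : ℝ)⁻¹ • ind s

variable {G}

theorem form_self_nonneg (h : SmallestEigenvalueGE G (-3)) (u : V → ℝ) : 0 ≤ form G u u := by
  set M : Matrix V V ℝ := G.adjMatrix ℝ + (3 : ℝ) • (1 : Matrix V V ℝ) with hM
  have hH : M.IsHermitian := by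
    rw [Matrix.IsHermitian, Matrix.conjTranspose_eq_transpose_of_trivial, hM,
      Matrix.transpose_add, Matrix.transpose_smul, Matrix.transpose_one,
      SimpleGraph.transpose_adjMatrix]
  have hP : M.PosSemidef := by
    rw [hH.posSemidef_iff_eigenvalues_nonneg]
    intro i
    have hv := hH.mulVec_eigenvectorBasis i
    set v : V → ℝ := (hH.eigenvectorBasis i).ofLp with hvdef
    have hv0 : v ≠ 0 := by
      intro h0
      have := (hH.eigenvectorBasis.orthonormal).ne_zero i
      apply this
      ext j
      exact congrFun h0 j
    have hA : Matrix.toLin' (G.adjMatrix ℝ) v = (hH.eigenvalues i - 3) • v := by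
      have hMv : M.mulVec v = (G.adjMatrix ℝ).mulVec v + (3 : ℝ) • v := by
        rw [hM, Matrix.add_mulVec, Matrix.smul_mulVec, Matrix.one_mulVec]
      rw [Matrix.toLin'_apply, sub_smul, ← hv, hMv, add_sub_cancel_right]
    have := h (hH.eigenvalues i - 3)
      (Module.End.hasEigenvalue_of_hasEigenvector
        ⟨Module.End.mem_eigenspace_iff.mpr hA, hv0⟩)
    simp only [Pi.zero_apply]
    linarith
  have := hP.dotProduct_mulVec_nonneg u
  rw [form, Matrix.toBilin'_apply']
  simpa using this

theorem form_vtx_vtx (x y : V) :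
    form G (vtx x) (vtx y) = (if G.Adj x y then 1 else 0) + if x = y then 3 else 0 := by
  rw [form, vtx, vtx, Matrix.toBilin'_single]
  simp [Matrix.one_apply]

theorem form_vtx_self (x : V) : form G (vtx x) (vtx x) = 3 := by
  simp [form_vtx_vtx]

theorem form_vtx_of_adj {x y : V} (h : G.Adj x y) : form G (vtx x) (vtx y) = 1 := by
  simp [form_vtx_vtx, h, h.ne]

theorem form_comm (u v : V → ℝ) : form G u v = form G v u := by
  have hM : (G.adjMatrix ℝ + (3 : ℝ) • (1 : Matrix V V ℝ)).transpose
      = G.adjMatrix ℝ + (3 : ℝ) • (1 : Matrix V V ℝ) := by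
    rw [Matrix.transpose_add, Matrix.transpose_smul, Matrix.transpose_one,
      SimpleGraph.transpose_adjMatrix]
  rw [form, Matrix.toBilin'_apply', Matrix.toBilin'_apply', Matrix.dotProduct_mulVec,
    ← Matrix.mulVec_transpose, hM, dotProduct_comm]

theorem form_vtx_ind (x : V) (s : Finset V) :
    form G (vtx x) (ind s) = (s.filter (G.Adj x)).card + if x ∈ s then 3 else 0 := by
  simp only [ind, map_sum, form_vtx_vtx, Finset.sum_add_distrib]
  simp

theorem form_ind_left (s : Finset V) (v : V → ℝ) :
    form G (ind s) v = ∑ u ∈ s, form G (vtx u) v := by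
  simp [ind]

theorem form_avg_left (s : Finset V) (v : V → ℝ) :
    form G (avg s) v = (s.card : ℝ)⁻¹ * ∑ u ∈ s, form G (vtx u) v := by
  simp [avg, form_ind_left]

theorem form_vtx_avg (x : V) (s : Finset V) :
    form G (vtx x) (avg s) = (s.card : ℝ)⁻¹ * form G (vtx x) (ind s) := by
  simp [avg]

theorem form_vtx_ind_of_mem {s : Finset V} (hs : G.IsClique (s : Set V)) {x : V} (hx : x ∈ s) :
    form G (vtx x) (ind s) = s.card + 2 := by
  rw [form_vtx_ind, filter_adj_of_isClique hs hx, if_pos hx, Finset.cast_card_erase_of_mem hx]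
  ring

theorem form_ind_self {s : Finset V} (hs : G.IsClique (s : Set V)) :
    form G (ind s) (ind s) = s.card * (s.card + 2) := by
  rw [form_ind_left, Finset.sum_congr rfl fun u hu => form_vtx_ind_of_mem hs hu,
    Finset.sum_const, nsmul_eq_mul]

theorem form_vtx_avg_of_mem {s : Finset V} (hs : G.IsClique (s : Set V)) {x : V} (hx : x ∈ s) :
    form G (vtx x) (avg s) = 1 + 2 / s.card := by
  have : (s.card : ℝ) ≠ 0 := by
    have := Finset.card_pos.mpr ⟨x, hx⟩
    positivity
  rw [form_vtx_avg, form_vtx_ind_of_mem hs hx]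
  field_simp

theorem form_avg_self {s : Finset V} (hs : G.IsClique (s : Set V)) (hne : s.Nonempty) :
    form G (avg s) (avg s) = 1 + 2 / s.card := by
  have : (s.card : ℝ) ≠ 0 := by
    have := Finset.card_pos.mpr hne
    positivity
  rw [form_avg_left, Finset.sum_congr rfl fun u hu => form_vtx_avg_of_mem hs hu]
  simp only [Finset.sum_const, nsmul_eq_mul]
  field_simp

theorem form_vtx_avg_of_notMem {s : Finset V} {x : V} (hx : x ∉ s) :
    form G (vtx x) (avg s) = (s.filter (G.Adj x)).card / s.card := by
  rw [form_vtx_avg, form_vtx_ind, if_neg hx]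
  ring

/-- If a vertex has `a` neighbours and `b` non-neighbours in a clique missing it, and
`λ_min ≥ -3`, then `ab ≤ 4a + 6b + 12`. -/
theorem card_mul_card_le (h : SmallestEigenvalueGE G (-3)) {s : Finset V}
    (hs : G.IsClique (s : Set V)) {x : V} (hx : x ∉ s) :
    (s.filter (G.Adj x)).card * (s.filter (¬ G.Adj x ·)).card ≤
      4 * (s.filter (G.Adj x)).card + 6 * (s.filter (¬ G.Adj x ·)).card + 12 := by
  set S := s.filter (G.Adj x) with hS
  set T := s.filter (¬ G.Adj x ·) with hT
  have hSc : G.IsClique (S : Set V) := hs.subset (Finset.coe_subset.mpr (Finset.filter_subset _ _))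
  have hTc : G.IsClique (T : Set V) := hs.subset (Finset.coe_subset.mpr (Finset.filter_subset _ _))
  rcases Nat.eq_zero_or_pos S.card with h0 | hpos
  · simp [h0]
  have hxS : form G (vtx x) (ind S) = S.card := by
    rw [form_vtx_ind, if_neg (by simp [hS]), add_zero, Finset.filter_true_of_mem]
    intro y hy
    exact (Finset.mem_filter.mp hy).2
  have hxT : form G (vtx x) (ind T) = 0 := by
    rw [form_vtx_ind, if_neg (by simp [hT, hx]), add_zero, Finset.filter_false_of_mem]
    · simp
    intro y hy
    exact (Finset.mem_filter.mp hy).2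
  have hST : form G (ind S) (ind T) = S.card * T.card := by
    rw [form_ind_left, Finset.sum_congr rfl (g := fun _ => (T.card : ℝ))]
    · simp
    intro u hu
    have hu' := Finset.mem_filter.mp hu
    rw [form_vtx_ind, if_neg (by simp [hT, hu'.2]), add_zero, Finset.filter_true_of_mem]
    intro y hy
    have hy' := Finset.mem_filter.mp hy
    exact hs (by simpa using hu'.1) (by simpa using hy'.1) fun h => hy'.2 (h ▸ hu'.2)
  set a : ℝ := (S.card : ℝ)
  set b : ℝ := (T.card : ℝ)
  have ha : 0 < a := by simpa [a] using hpos
  have hb : 0 ≤ b := by simp [b]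
  -- Up to scaling, this is the component of `ind S` orthogonal to `vtx x` and `ind T`.
  have key := form_self_nonneg h
    ((-(a * (b + 2))) • vtx x + (3 * (b + 2)) • ind S + (-(3 * a)) • ind T)
  simp only [map_add, map_smul, LinearMap.add_apply, LinearMap.smul_apply, smul_eq_mul,
    form_comm (ind S) (vtx x), form_comm (ind T) (vtx x), form_comm (ind T) (ind S),
    hxS, hxT, hST, form_vtx_self, form_ind_self hSc, form_ind_self hTc] at key
  change 0 ≤ _ at key
  have e : 0 ≤ (3 * a * (b + 2)) * (4 * a + 6 * b + 12 - a * b) := by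
    refine key.trans_eq ?_
    ring
  have := nonneg_of_mul_nonneg_right e (by positivity)
  have h' : a * b ≤ 4 * a + 6 * b + 12 := by linarith
  have h'' : (S.card : ℝ) * T.card ≤ 4 * S.card + 6 * T.card + 12 := h'
  exact_mod_cast h''

/-- Independent sets of neighbours have at most nine elements if `λ_min ≥ -3`. -/
theorem card_indep_le (h : SmallestEigenvalueGE G (-3)) {x : V} {I : Finset V}
    (hI : ∀ y ∈ I, G.Adj x y) (hind : ∀ y ∈ I, ∀ z ∈ I, ¬ G.Adj y z) : I.card ≤ 9 := by
  have h1 : form G (vtx x) (ind I) = I.card := by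
    rw [form_vtx_ind, if_neg (fun hx => (hI x hx).ne rfl), add_zero,
      Finset.filter_true_of_mem hI]
  have h2 : form G (ind I) (ind I) = I.card * 3 := by
    rw [form_ind_left, Finset.sum_congr rfl (g := fun _ => (3 : ℝ))]
    · simp
    intro u hu
    rw [form_vtx_ind, if_pos hu, Finset.filter_false_of_mem (hind u hu)]
    simp
  -- The value of the form at this vector is `27 - 3|I|`.
  have key := form_self_nonneg h ((3 : ℝ) • vtx x - ind I)
  simp only [map_sub, map_smul, LinearMap.sub_apply, LinearMap.smul_apply, smul_eq_mul,
    form_comm (ind I) (vtx x), h1, h2, form_vtx_self] at key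
  have : (I.card : ℝ) ≤ 9 := by linarith
  exact_mod_cast this

end GramForm

/-! ### Big cliques: few outside neighbours, and two through each vertex -/

namespace GramForm

/-- The maximal cliques with at least `q` vertices. -/
def IsBigClique {V : Type u} (G : SimpleGraph V) (q : ℕ) (C : Finset V) : Prop :=
  Maximal G.IsClique (C : Set V) ∧ q ≤ C.card

theorem exists_not_adj_of_maximal {V : Type u} {G : SimpleGraph V} {s : Finset V}
    (hs : Maximal G.IsClique (s : Set V)) {x : V} (hx : x ∉ s) : ∃ y ∈ s, ¬ G.Adj x y := by
  by_contra! hcon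
  refine hx ?_
  have h := hs.le_of_ge (y := insert x (s : Set V))
    (hs.prop.insert fun y hy _ => hcon y hy) (Set.subset_insert _ _)
  exact h (Set.mem_insert _ _)

theorem exists_maximal_isClique {V : Type u} [Fintype V] {G : SimpleGraph V} {s : Finset V}
    (hs : G.IsClique (s : Set V)) : ∃ C : Finset V, Maximal G.IsClique (C : Set V) ∧ s ⊆ C := by
  classical
  obtain ⟨C, hsC, hC⟩ := (Set.toFinite {S : Set V | G.IsClique S}).exists_le_maximal hs
  refine ⟨C.toFinset, ?_, ?_⟩
  · simpa using hC
  · intro x hx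
    simpa using hsC hx

theorem card_common_le {V : Type u} [Fintype V] {G : SimpleGraph V} {c : ℕ}
    (hmu : IsMuBounded G c) {x y : V} (hxy : x ≠ y)
    (h : ¬ G.Adj x y) {s : Finset V} (hs : ∀ z ∈ s, G.Adj x z ∧ G.Adj y z) : s.card ≤ c := by
  refine le_trans ?_ (hmu x y hxy h)
  rw [← Set.ncard_coe_finset]
  exact Set.ncard_le_ncard (fun z hz => hs z hz) (Set.toFinite _)

theorem IsBigClique.card_ge {V : Type u} {G : SimpleGraph V} {c q : ℕ}
(hq : q = max (c + 5) (50 * min c 6 + 16))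
    {s : Finset V} (hs : IsBigClique G q s) : 50 * (min c 6 : ℕ) + 16 ≤ s.card :=
  le_trans (by omega) hs.2

variable {V : Type u} [Fintype V] [DecidableEq V] {G : SimpleGraph V} [DecidableRel G.Adj]

/-- By maximality `x` misses some `y ∈ s`, and the neighbours of `x` in `s` are common neighbours of
`x` and `y`; this gives the bound `c`. The bound 6 comes from the eigenvalue, through
`card_mul_card_le`. -/
theorem card_filter_adj_le {c q : ℕ} (hq : q = max (c + 5) (50 * min c 6 + 16))
    (hmu : IsMuBounded G c) (heig : SmallestEigenvalueGE G (-3)) {s : Finset V}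
    (hs : IsBigClique G q s) {x : V} (hx : x ∉ s) : (s.filter (G.Adj x)).card ≤ min c 6 := by
  obtain ⟨y, hy, hxy⟩ := exists_not_adj_of_maximal hs.1 hx
  have hac : (s.filter (G.Adj x)).card ≤ c := by
    refine card_common_le (x := x) (y := y) hmu (fun h => hx (h ▸ hy)) hxy fun z hz => ?_
    rw [Finset.mem_filter] at hz
    exact ⟨hz.2, hs.1.prop (by simpa using hy) (by simpa using hz.1) fun h => hxy (h ▸ hz.2)⟩
  refine le_min hac ?_
  by_contra! h7
  have hmul := card_mul_card_le heig hs.1.prop hx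
  have hsum := Finset.card_filter_add_card_filter_not (s := s) (G.Adj x)
  have hcard := hs.2
  generalize (s.filter (G.Adj x)).card = a at *
  generalize (s.filter (¬ G.Adj x ·)).card = b at *
  have hc6 : min c 6 = 6 := by omega
  rw [hc6] at hq
  -- The term `c + 5` in `q` serves here: `a ≤ c` and `a + b ≥ c + 5`.
  have hb : 5 ≤ b := by omega
  -- `hmul` says `(a - 6)(b - 4) ≤ 36`; with both factors positive this bounds `a + b` well below
  -- the 316 vertices of `s`.
  obtain ⟨a', rfl⟩ : ∃ a', a = a' + 7 := ⟨a - 7, by omega⟩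
  obtain ⟨b', rfl⟩ : ∃ b', b = b' + 5 := ⟨b - 5, by omega⟩
  have h1 : a' ≤ 35 := by nlinarith
  have h2 : b' ≤ 175 := by nlinarith
  omega

theorem form_vtx_avg_nonneg (x : V) (s : Finset V) : 0 ≤ form G (vtx x) (avg s) := by
  rw [form_vtx_avg, form_vtx_ind]
  positivity

theorem form_avg_nonneg (s t : Finset V) : 0 ≤ form G (avg s) (avg t) := by
  rw [form_avg_left]
  exact mul_nonneg (by positivity) (Finset.sum_nonneg fun u _ => form_vtx_avg_nonneg u t)

theorem form_vtx_avg_le {c q : ℕ} (hq : q = max (c + 5) (50 * min c 6 + 16))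
    (hmu : IsMuBounded G c) (heig : SmallestEigenvalueGE G (-3)) {s : Finset V}
    (hs : IsBigClique G q s) {x : V} (hx : x ∉ s) : form G (vtx x) (avg s) ≤ 1 / 50 := by
  have h1 := card_filter_adj_le hq hmu heig hs hx
  have h2 := hs.card_ge hq
  have h3 : 50 * (s.filter (G.Adj x)).card ≤ s.card := by omega
  have h3' : 50 * ((s.filter (G.Adj x)).card : ℝ) ≤ s.card := by exact_mod_cast h3
  have h4 : (0 : ℝ) < s.card := by exact_mod_cast (by omega : 0 < s.card)
  rw [form_vtx_avg_of_notMem hx, div_le_div_iff₀ h4 (by norm_num)]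
  linarith

/-- A vertex of `s` outside `t` is adjacent to all of `s ∩ t`, so at most `|s|/50` vertices are
shared. Each of these contributes at most `34/33`, since `|t| ≥ 66`, and the others at most `1/50`;
finally `(1/50)(1 + 34/33) < 1/24`. -/
theorem form_avg_avg_le {c q : ℕ} (hc : 1 ≤ c) (hq : q = max (c + 5) (50 * min c 6 + 16))
    (hmu : IsMuBounded G c) (heig : SmallestEigenvalueGE G (-3)) {s t : Finset V}
    (hs : IsBigClique G q s) (ht : IsBigClique G q t) (hst : s ≠ t) :
    form G (avg s) (avg t) ≤ 1 / 24 := by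
  have hs2 := hs.card_ge hq
  have ht2 := ht.card_ge hq
  obtain ⟨x, hxs, hxt⟩ : ∃ x ∈ s, x ∉ t := by
    by_contra! hcon
    apply hst
    have : (s : Set V) = t := hs.1.eq_of_le ht.1.prop hcon
    exact_mod_cast this
  have hinter : (s.filter (· ∈ t)).card ≤ min c 6 := by
    refine le_trans (Finset.card_le_card fun y hy => ?_)
      (card_filter_adj_le hq hmu heig ht hxt)
    rw [Finset.mem_filter] at hy ⊢
    exact ⟨hy.2, hs.1.prop (by simpa using hxs) (by simpa using hy.1)
      fun h => hxt (h ▸ hy.2)⟩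
  have hs0 : (0 : ℝ) < s.card := by exact_mod_cast (by omega : 0 < s.card)
  have ht66 : (66 : ℝ) ≤ t.card := by exact_mod_cast (by omega : 66 ≤ t.card)
  have hinter' : 50 * ((s.filter (· ∈ t)).card : ℝ) ≤ s.card := by
    exact_mod_cast (by omega : 50 * (s.filter (· ∈ t)).card ≤ s.card)
  have hsum : ∑ u ∈ s, form G (vtx u) (avg t) ≤
      ∑ u ∈ s, ((1 / 50 : ℝ) + if u ∈ t then 34 / 33 else 0) := by
    refine Finset.sum_le_sum fun u _ => ?_
    split_ifs with hu
    · rw [form_vtx_avg_of_mem ht.1.prop hu]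
      have : (2 : ℝ) / t.card ≤ 2 / 66 := by gcongr
      linarith
    · have := form_vtx_avg_le hq hmu heig ht hu
      linarith
  rw [form_avg_left, inv_mul_le_iff₀ hs0]
  refine hsum.trans ?_
  rw [Finset.sum_add_distrib, ← Finset.sum_filter, Finset.sum_const, Finset.sum_const]
  simp only [nsmul_eq_mul]
  linarith

/-- Every vertex lies in two different maximal cliques with at least `q` vertices. -/
theorem exists_two_isBigClique {c q K : ℕ} (hc : 1 ≤ c)
    (hq : q = max (c + 5) (50 * min c 6 + 16))
    (hK : K = max (36 * c + 400 * min c 6 + 83) (44 * c - 5))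
    (hmu : IsMuBounded G c)
    (hclique : ∀ C : Finset V, G.IsClique (C : Set V) → ∀ x ∈ C, C.card + K ≤ G.degree x)
    (heig : SmallestEigenvalueGE G (-3)) (x : V) :
    ∃ s t, IsBigClique G q s ∧ IsBigClique G q t ∧ s ≠ t ∧ x ∈ s ∧ x ∈ t := by
  set N := G.neighborFinset x with hN
  have memN : ∀ y, y ∈ N ↔ G.Adj x y := fun y => by simp [hN]
  obtain ⟨I, hImem, hImax⟩ := Finset.exists_max_image
    (N.powerset.filter fun I => ∀ y ∈ I, ∀ z ∈ I, ¬ G.Adj y z) Finset.card ⟨∅, by simp⟩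
  rw [Finset.mem_filter, Finset.mem_powerset] at hImem
  obtain ⟨hIN, hI⟩ := hImem
  replace hImax : ∀ J : Finset V, J ⊆ N → (∀ y ∈ J, ∀ z ∈ J, ¬ G.Adj y z) →
      J.card ≤ I.card := fun J h1 h2 =>
    hImax J (Finset.mem_filter.mpr ⟨Finset.mem_powerset.mpr h1, h2⟩)
  have hI9 : I.card ≤ 9 := card_indep_le heig (fun y hy => (memN y).1 (hIN hy)) hI
  -- The private neighbours of `y`. Two non-adjacent ones could replace `y` in `I`, against
  -- maximality, so together with `x` they form a clique.
  let A : V → Finset V := fun y => N.filter fun z => ∀ y' ∈ I, (z = y' ∨ G.Adj z y') ↔ y' = y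
  have hAself : ∀ y ∈ I, y ∈ A y := by
    intro y hy
    refine Finset.mem_filter.mpr ⟨hIN hy, fun y' hy' => ?_⟩
    have := hI y hy y' hy'
    tauto
  have hAclique : ∀ y ∈ I, G.IsClique (insert x (A y) : Set V) := by
    intro y hy
    refine SimpleGraph.IsClique.insert ?_ fun z hz _ => (memN z).1 (Finset.mem_filter.mp hz).1
    intro u hu v hv huv
    by_contra hadj
    have hu' := Finset.mem_filter.mp hu
    have hv' := Finset.mem_filter.mp hv
    have huI : ∀ y' ∈ I.erase y, u ≠ y' ∧ ¬ G.Adj u y' := fun y' hy' => by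
      have := hu'.2 y' (Finset.mem_of_mem_erase hy')
      have := Finset.ne_of_mem_erase hy'
      tauto
    have hvI : ∀ y' ∈ I.erase y, v ≠ y' ∧ ¬ G.Adj v y' := fun y' hy' => by
      have := hv'.2 y' (Finset.mem_of_mem_erase hy')
      have := Finset.ne_of_mem_erase hy'
      tauto
    have hvn : v ∉ I.erase y := fun h => (hvI v h).1 rfl
    have hun : u ∉ insert v (I.erase y) := by
      rw [Finset.mem_insert, not_or]
      exact ⟨huv, fun h => (huI u h).1 rfl⟩
    have hle := hImax (insert u (insert v (I.erase y))) (by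
      intro z hz
      rw [Finset.mem_insert, Finset.mem_insert] at hz
      rcases hz with rfl | rfl | hz
      · exact hu'.1
      · exact hv'.1
      · exact hIN (Finset.mem_of_mem_erase hz)) (by
      intro a ha b hb
      rw [Finset.mem_insert, Finset.mem_insert] at ha hb
      rcases ha with rfl | rfl | ha <;> rcases hb with rfl | rfl | hb
      · exact G.loopless.irrefl _
      · exact hadj
      · exact (huI b hb).2
      · exact fun h => hadj h.symm
      · exact G.loopless.irrefl _
      · exact (hvI b hb).2
      · exact fun h => (huI a ha).2 h.symm
      · exact fun h => (hvI a ha).2 h.symm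
      · exact hI a (Finset.mem_of_mem_erase ha) b (Finset.mem_of_mem_erase hb))
    rw [Finset.card_insert_of_notMem hun, Finset.card_insert_of_notMem hvn,
      Finset.card_erase_of_mem hy] at hle
    have := Finset.card_pos.mpr ⟨y, hy⟩
    omega
  have hcover : N ⊆ I.biUnion A ∪ (I.powersetCard 2).biUnion
      fun p => N.filter fun z => ∀ y ∈ p, G.Adj z y := by
    intro z hz
    rw [Finset.mem_union, Finset.mem_biUnion, Finset.mem_biUnion]
    by_cases hzI : z ∈ I
    · exact Or.inl ⟨z, hzI, hAself z hzI⟩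
    by_cases h1 : ∃ y ∈ I, G.Adj z y
    · obtain ⟨y, hy, hzy⟩ := h1
      by_cases h2 : ∃ y' ∈ I, y' ≠ y ∧ G.Adj z y'
      · obtain ⟨y', hy', hne, hzy'⟩ := h2
        refine Or.inr ⟨{y, y'}, ?_, ?_⟩
        · rw [Finset.mem_powersetCard]
          refine ⟨?_, Finset.card_pair hne.symm⟩
          intro w hw
          rw [Finset.mem_insert, Finset.mem_singleton] at hw
          rcases hw with rfl | rfl <;> assumption
        · refine Finset.mem_filter.mpr ⟨hz, fun w hw => ?_⟩
          rw [Finset.mem_insert, Finset.mem_singleton] at hw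
          rcases hw with rfl | rfl <;> assumption
      · push Not at h2
        refine Or.inl ⟨y, hy, Finset.mem_filter.mpr ⟨hz, fun y' hy' => ⟨?_, ?_⟩⟩⟩
        · rintro (rfl | h)
          · exact absurd hy' hzI
          · by_contra hne
            exact h2 y' hy' hne h
        · rintro rfl
          exact Or.inr hzy
    · push Not at h1
      exfalso
      have hle := hImax (insert z I) (Finset.insert_subset hz hIN) (by
        intro a ha b hb
        rw [Finset.mem_insert] at ha hb
        rcases ha with rfl | ha <;> rcases hb with rfl | hb
        · exact G.loopless.irrefl _
        · exact h1 b hb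
        · exact fun h => h1 a ha h.symm
        · exact hI a ha b hb)
      rw [Finset.card_insert_of_notMem hzI] at hle
      omega
  -- Two members of `I` are non-adjacent and already have `x` as a common neighbour, which leaves `c
  -- - 1` others for each of at most 36 pairs.
  have hrest : ((I.powersetCard 2).biUnion
      fun p => N.filter fun z => ∀ y ∈ p, G.Adj z y).card ≤ 36 * (c - 1) := by
    have h1 := Finset.card_biUnion_le_card_mul (I.powersetCard 2)
      (fun p => N.filter fun z => ∀ y ∈ p, G.Adj z y) (c - 1) (by
        intro p hp
        rw [Finset.mem_powersetCard, Finset.card_eq_two] at hp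
        obtain ⟨hpI, y, y', hne, rfl⟩ := hp
        have hy : y ∈ I := hpI (by simp)
        have hy' : y' ∈ I := hpI (by simp)
        have hx : x ∉ N.filter fun z => ∀ w ∈ ({y, y'} : Finset V), G.Adj z w := fun h =>
          ((memN x).1 (Finset.mem_filter.mp h).1).ne rfl
        have := card_common_le hmu hne (hI y hy y' hy')
          (s := insert x (N.filter fun z => ∀ w ∈ ({y, y'} : Finset V), G.Adj z w)) (by
            intro z hz
            rw [Finset.mem_insert] at hz
            rcases hz with rfl | hz
            · exact ⟨((memN y).1 (hIN hy)).symm, ((memN y').1 (hIN hy')).symm⟩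
            · have := (Finset.mem_filter.mp hz).2
              exact ⟨(this y (by simp)).symm, (this y' (by simp)).symm⟩)
        rw [Finset.card_insert_of_notMem hx] at this
        omega)
    refine h1.trans (Nat.mul_le_mul_right _ ?_)
    rw [Finset.card_powersetCard]
    calc I.card.choose 2 ≤ Nat.choose 9 2 := Nat.choose_le_choose 2 hI9
      _ = 36 := by decide
  have hdeg : G.degree x ≤ ∑ y ∈ I, (A y).card + 36 * (c - 1) := by
    rw [← SimpleGraph.card_neighborFinset_eq_degree]
    refine (Finset.card_le_card hcover).trans ((Finset.card_union_le _ _).trans ?_)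
    exact Nat.add_le_add Finset.card_biUnion_le hrest
  have hAcard : ∀ y ∈ I, (A y).card + 1 + K ≤ G.degree x := by
    intro y hy
    have h := hclique (insert x (A y)) (by simpa using hAclique y hy) x
      (Finset.mem_insert_self _ _)
    rwa [Finset.card_insert_of_notMem fun h =>
      ((memN x).1 (Finset.mem_filter.mp h).1).ne rfl] at h
  have h0 := hclique {x} (by simp) x (by simp)
  rw [Finset.card_singleton] at h0
  obtain ⟨y, hy, y', hy', hne, hyq, hyq'⟩ :
      ∃ y ∈ I, ∃ y' ∈ I, y ≠ y' ∧ q ≤ (A y).card + 1 ∧ q ≤ (A y').card + 1 := by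
    by_contra! hcon
    obtain ⟨y₀, hy₀, hsmall⟩ : ∃ y₀ ∈ I, ∀ y ∈ I.erase y₀, (A y).card ≤ q - 2 := by
      by_cases hbig : ∃ y₀ ∈ I, q ≤ (A y₀).card + 1
      · obtain ⟨y₀, hy₀, hb⟩ := hbig
        refine ⟨y₀, hy₀, fun y hy => ?_⟩
        have := hcon y₀ hy₀ y (Finset.mem_of_mem_erase hy) (Finset.ne_of_mem_erase hy).symm hb
        omega
      · push Not at hbig
        rcases I.eq_empty_or_nonempty with rfl | ⟨y₀, hy₀⟩
        · rw [Finset.sum_empty] at hdeg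
          omega
        · refine ⟨y₀, hy₀, fun y hy => ?_⟩
          have := hbig y (Finset.mem_of_mem_erase hy)
          omega
    -- Now `deg x ≤ |A y₀| + 8(q - 2) + 36(c - 1)`, whereas `|A y₀| + 1 + K ≤ deg x`. The two terms
    -- of `K` match the two terms of `q`: in fact `8(q - 2) + 36(c - 1) = K - 7`.
    rw [← Finset.add_sum_erase I _ hy₀] at hdeg
    have h1 := Finset.sum_le_card_nsmul _ _ _ hsmall
    rw [Finset.card_erase_of_mem hy₀, smul_eq_mul] at h1
    have h2 : (I.card - 1) * (q - 2) ≤ 8 * (q - 2) := Nat.mul_le_mul_right _ (by omega)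
    have h3 := hAcard y₀ hy₀
    omega
  obtain ⟨s, hs, hss⟩ := exists_maximal_isClique (s := insert x (A y))
    (by simpa using hAclique y hy)
  obtain ⟨t, ht, hts⟩ := exists_maximal_isClique (s := insert x (A y'))
    (by simpa using hAclique y' hy')
  have hxA : ∀ y, x ∉ A y := fun y h => ((memN x).1 (Finset.mem_filter.mp h).1).ne rfl
  refine ⟨s, t, ⟨hs, ?_⟩, ⟨ht, ?_⟩, ?_, hss (Finset.mem_insert_self _ _),
    hts (Finset.mem_insert_self _ _)⟩
  · have := Finset.card_le_card hss
    rw [Finset.card_insert_of_notMem (hxA y)] at this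
    omega
  · have := Finset.card_le_card hts
    rw [Finset.card_insert_of_notMem (hxA y')] at this
    omega
  · rintro rfl
    refine hI y hy y' hy' (hs.prop ?_ ?_ hne)
    · exact hss (Finset.mem_insert_of_mem (hAself y hy))
    · exact hts (Finset.mem_insert_of_mem (hAself y' hy'))

end GramForm

/-! ### Residuals of vertices modulo nearly orthonormal clique averages -/

namespace GramForm

variable {V : Type u} [Fintype V] [DecidableEq V] {G : SimpleGraph V} [DecidableRel G.Adj]

/-- The form `A + 3I` is positive semidefinite, and the members of the family `P` are cliques
whose average vectors are nearly orthonormal, and nearly orthogonal to outside vertices. -/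
structure CliqueGram (G : SimpleGraph V) [DecidableRel G.Adj] (P : Finset V → Prop) : Prop where
  psd : ∀ u, 0 ≤ form G u u
  clique : ∀ s, P s → G.IsClique (s : Set V)
  one_le : ∀ s, P s → 1 ≤ form G (avg s) (avg s)
  mem : ∀ s, P s → ∀ x ∈ s, form G (vtx x) (avg s) = form G (avg s) (avg s)
  notMem : ∀ s, P s → ∀ x ∉ s, form G (vtx x) (avg s) ≤ 1 / 50
  ne : ∀ s, P s → ∀ t, P t → s ≠ t → form G (avg s) (avg t) ≤ 1 / 24

theorem cliqueGram_isBigClique {c q : ℕ} (hc : 1 ≤ c) (hq : q = max (c + 5) (50 * min c 6 + 16))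
    (hmu : IsMuBounded G c) (heig : SmallestEigenvalueGE G (-3)) :
    CliqueGram G (IsBigClique G q) := by
  have hne : ∀ s, IsBigClique G q s → s.Nonempty := fun s hs =>
    Finset.card_pos.mp (by have := hs.card_ge hq; omega)
  refine ⟨form_self_nonneg heig, fun s hs => hs.1.prop, fun s hs => ?_, fun s hs x hx => ?_,
    fun s hs x hx => form_vtx_avg_le hq hmu heig hs hx,
    fun s hs t ht hst => form_avg_avg_le hc hq hmu heig hs ht hst⟩
  · rw [form_avg_self hs.1.prop (hne s hs)]
    have : (0 : ℝ) ≤ 2 / s.card := by positivity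
    linarith
  · rw [form_avg_self hs.1.prop (hne s hs), form_vtx_avg_of_mem hs.1.prop hx]

/-- The part of a vertex vector left over by the averages of two cliques. -/
noncomputable def res (x : V) (s t : Finset V) : V → ℝ := vtx x - avg s - avg t

/-- `x` and `y` are adjacent but not in a common member of `P`. -/
def Uncovered (G : SimpleGraph V) (P : Finset V → Prop) (x y : V) : Prop :=
  G.Adj x y ∧ ∀ s, P s → x ∈ s → y ∉ s

theorem form_avg_vtx (s : Finset V) (x : V) :
    form G (avg s) (vtx x) = form G (vtx x) (avg s) := form_comm _ _

theorem form_vtx_vtx_le {x y : V} (h : x ≠ y) : form G (vtx x) (vtx y) ≤ 1 := by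
  rw [form_vtx_vtx, if_neg h]
  split_ifs <;> norm_num

theorem form_res_res (x y : V) (s t s' t' : Finset V) :
    form G (res x s t) (res y s' t') = form G (vtx x) (vtx y)
      - form G (vtx x) (avg s') - form G (vtx x) (avg t')
      - form G (vtx y) (avg s) - form G (vtx y) (avg t)
      + form G (avg s) (avg s') + form G (avg s) (avg t')
      + form G (avg t) (avg s') + form G (avg t) (avg t') := by
  simp only [res, map_sub, LinearMap.sub_apply, form_avg_vtx]
  ring

/-- `s` and `t` are the only members of `P` containing `x`. -/
def OnlyTwo (P : Finset V → Prop) (x : V) (s t : Finset V) : Prop :=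
  P s ∧ P t ∧ s ≠ t ∧ x ∈ s ∧ x ∈ t ∧ ∀ r, P r → x ∈ r → r = s ∨ r = t

namespace CliqueGram

variable {P : Finset V → Prop} {x y z : V} {s t s' t' r : Finset V}

/-- The residual modulo four averages would have square norm at most `3 - 4 + 12/24 < 0`. -/
theorem not_four (hP : CliqueGram G P) (h1 : P s ∧ x ∈ s) (h2 : P t ∧ x ∈ t) (h3 : P s' ∧ x ∈ s')
    (h4 : P t' ∧ x ∈ t') (h12 : s ≠ t) (h13 : s ≠ s') (h14 : s ≠ t') (h23 : t ≠ s')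
    (h24 : t ≠ t') (h34 : s' ≠ t') : False := by
  have key := hP.psd (vtx x - avg s - avg t - avg s' - avg t')
  simp only [map_sub, LinearMap.sub_apply, form_avg_vtx, form_vtx_self,
    form_comm (avg t) (avg s), form_comm (avg s') (avg s), form_comm (avg t') (avg s),
    form_comm (avg s') (avg t), form_comm (avg t') (avg t), form_comm (avg t') (avg s'),
    hP.mem s h1.1 x h1.2, hP.mem t h2.1 x h2.2, hP.mem s' h3.1 x h3.2,
    hP.mem t' h4.1 x h4.2] at key
  linarith [hP.one_le s h1.1, hP.one_le t h2.1, hP.one_le s' h3.1, hP.one_le t' h4.1,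
    hP.ne s h1.1 t h2.1 h12, hP.ne s h1.1 s' h3.1 h13, hP.ne s h1.1 t' h4.1 h14,
    hP.ne t h2.1 s' h3.1 h23, hP.ne t h2.1 t' h4.1 h24, hP.ne s' h3.1 t' h4.1 h34]

/-- Cauchy–Schwarz: the residual modulo three averages has square norm at most `1/4`, so its product
with any vertex vector is small. -/
theorem form_vtx_triple_lt (hP : CliqueGram G P)
    (h1 : P s ∧ x ∈ s) (h2 : P t ∧ x ∈ t) (h3 : P r ∧ x ∈ r)
    (h12 : s ≠ t) (h13 : s ≠ r) (h23 : t ≠ r) (y : V) :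
    |form G (vtx y) (vtx x) - form G (vtx y) (avg s) - form G (vtx y) (avg t)
      - form G (vtx y) (avg r)| ≤ 7 / 8 := by
  have key := fun a : ℝ => hP.psd (vtx x - avg s - avg t - avg r + a • vtx y)
  simp only [map_sub, map_add, map_smul, LinearMap.sub_apply, LinearMap.add_apply,
    LinearMap.smul_apply, smul_eq_mul, form_avg_vtx, form_vtx_self,
    form_comm (avg t) (avg s), form_comm (avg r) (avg s), form_comm (avg r) (avg t),
    form_comm (vtx x) (vtx y),
    hP.mem s h1.1 x h1.2, hP.mem t h2.1 x h2.2, hP.mem r h3.1 x h3.2] at key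
  -- Testing at `±1/3`, near the optimal multiple, keeps the bound rational: `(3/2)(1/4 + 1/3) =
  -- 7/8`.
  have k1 := key (1 / 3)
  have k2 := key (-(1 / 3))
  rw [abs_le]
  constructor <;>
  linarith [hP.one_le s h1.1, hP.one_le t h2.1, hP.one_le r h3.1,
    hP.ne s h1.1 t h2.1 h12, hP.ne s h1.1 r h3.1 h13, hP.ne t h2.1 r h3.1 h23]

/-- A neighbour outside all three cliques would have product at least `1 - 3/50 > 7/8` with the
residual of `x`. -/
theorem mem_of_triple (hP : CliqueGram G P) (h1 : P s ∧ x ∈ s) (h2 : P t ∧ x ∈ t) (h3 : P r ∧ x ∈ r)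
    (h12 : s ≠ t) (h13 : s ≠ r) (h23 : t ≠ r) (hxy : G.Adj x y) :
    y ∈ s ∨ y ∈ t ∨ y ∈ r := by
  by_contra! hcon
  have h := (abs_le.mp (hP.form_vtx_triple_lt h1 h2 h3 h12 h13 h23 y)).2
  rw [form_vtx_of_adj hxy.symm] at h
  linarith [hP.notMem s h1.1 y hcon.1, hP.notMem t h2.1 y hcon.2.1, hP.notMem r h3.1 y hcon.2.2]

/-- Such a `y` would have product at most `1 - 1 - 1 < -7/8` with the residual of `x`. -/
theorem not_mem_two_of_triple (hP : CliqueGram G P)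
    (h1 : P s ∧ x ∈ s) (h2 : P t ∧ x ∈ t) (h3 : P r ∧ x ∈ r)
    (h12 : s ≠ t) (h13 : s ≠ r) (h23 : t ≠ r) (hxy : x ≠ y) (hs : y ∈ s) (ht : y ∈ t) :
    False := by
  have h := (abs_le.mp (hP.form_vtx_triple_lt h1 h2 h3 h12 h13 h23 y)).1
  rw [hP.mem s h1.1 y hs, hP.mem t h2.1 y ht] at h
  linarith [hP.one_le s h1.1, hP.one_le t h2.1, form_vtx_avg_nonneg (G := G) y r,
    form_vtx_vtx_le (G := G) hxy.symm]

theorem form_res_self_le (hP : CliqueGram G P) (h1 : P s ∧ x ∈ s) (h2 : P t ∧ x ∈ t) (h12 : s ≠ t) :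
    form G (res x s t) (res x s t) ≤ 13 / 12 := by
  rw [form_res_res, form_vtx_self, form_comm (avg t) (avg s), hP.mem s h1.1 x h1.2,
    hP.mem t h2.1 x h2.2]
  linarith [hP.one_le s h1.1, hP.one_le t h2.1, hP.ne s h1.1 t h2.1 h12]

theorem le_form_res (hP : CliqueGram G P)
    (hxy : G.Adj x y) (h1 : P s) (h2 : P t) (h3 : P s') (h4 : P t')
    (hs : y ∉ s) (ht : y ∉ t) (hs' : x ∉ s') (ht' : x ∉ t') :
    23 / 25 ≤ form G (res x s t) (res y s' t') := by
  rw [form_res_res, form_vtx_of_adj hxy]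
  linarith [hP.notMem s h1 y hs, hP.notMem t h2 y ht, hP.notMem s' h3 x hs',
    hP.notMem t' h4 x ht', form_avg_nonneg (G := G) s s', form_avg_nonneg (G := G) s t',
    form_avg_nonneg (G := G) t s', form_avg_nonneg (G := G) t t']

theorem form_res_twin_le (hP : CliqueGram G P)
    (hxy : x ≠ y) (h1 : P s) (h2 : P t) (h12 : s ≠ t) (hxs : x ∈ s)
    (hxt : x ∈ t) (hys : y ∈ s) (hyt : y ∈ t) :
    form G (res x s t) (res y s t) ≤ -(11 / 12) := by
  rw [form_res_res, form_comm (avg t) (avg s), hP.mem s h1 x hxs,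
    hP.mem t h2 x hxt, hP.mem s h1 y hys, hP.mem t h2 y hyt]
  linarith [hP.one_le s h1, hP.one_le t h2, hP.ne s h1 t h2 h12,
    form_vtx_vtx_le (G := G) hxy]

/-- Sharing exactly one clique costs about 1 and so cancels a possible edge; sharing two gives about
`-1`; sharing none forces non-adjacency, leaving only four error terms `1/24`. -/
theorem form_res_le_of_not_uncovered (hP : CliqueGram G P) (hxy : x ≠ y) (hx : OnlyTwo P x s t)
    (hy : OnlyTwo P y s' t') (h : ¬ Uncovered G P x y) :
    form G (res x s t) (res y s' t') ≤ 1 / 6 := by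
  obtain ⟨h1, h2, h12, hxs, hxt, hx⟩ := hx
  obtain ⟨h3, h4, h34, hys, hyt, hy⟩ := hy
  have n1 := form_vtx_avg_nonneg (G := G) x s'
  have n2 := form_vtx_avg_nonneg (G := G) x t'
  have n3 := form_vtx_avg_nonneg (G := G) y s
  have n4 := form_vtx_avg_nonneg (G := G) y t
  have n5 := form_vtx_vtx_le (G := G) hxy
  have o1 := hP.one_le s h1
  have o2 := hP.one_le t h2
  by_cases e1 : s = s'
  · subst e1
    by_cases e2 : t = t'
    · subst e2
      linarith [hP.form_res_twin_le hxy h1 h2 h12 hxs hxt hys hyt]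
    rw [form_res_res, hP.mem s h1 x hxs, hP.mem s h1 y hys]
    linarith [hP.ne s h1 t' h4 h34, hP.ne t h2 s h1 h12.symm, hP.ne t h2 t' h4 e2]
  by_cases e2 : t = t'
  · subst e2
    rw [form_res_res, hP.mem t h2 x hxt, hP.mem t h2 y hyt]
    linarith [hP.ne s h1 s' h3 e1, hP.ne s h1 t h2 h12, hP.ne t h2 s' h3 h34.symm]
  by_cases e3 : s = t'
  · subst e3
    by_cases e4 : t = s'
    · subst e4
      have e : res y t s = res y s t := by simp only [res]; abel
      rw [e]
      linarith [hP.form_res_twin_le hxy h1 h2 h12 hxs hxt hyt hys]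
    rw [form_res_res, hP.mem s h1 x hxs, hP.mem s h1 y hyt]
    linarith [hP.ne s h1 s' h3 e1, hP.ne t h2 s' h3 e4, hP.ne t h2 s h1 e2]
  by_cases e4 : t = s'
  · subst e4
    rw [form_res_res, hP.mem t h2 x hxt, hP.mem t h2 y hys]
    linarith [hP.ne s h1 t h2 e1, hP.ne s h1 t' h4 e3, hP.ne t h2 t' h4 e2]
  have hadj : ¬ G.Adj x y := fun hadj => h ⟨hadj, fun r hr hxr hyr => by
    rcases hx r hr hxr with rfl | rfl <;> rcases hy _ hr hyr with h | h <;> contradiction⟩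
  have e0 : form G (vtx x) (vtx y) = 0 := by simp [form_vtx_vtx, hadj, hxy]
  rw [form_res_res]
  linarith [hP.ne s h1 s' h3 e1, hP.ne t h2 t' h4 e2, hP.ne s h1 t' h4 e3, hP.ne t h2 s' h3 e4]

/-- The residuals of `y` and `z` are both close to that of `x`, hence to each other, which is
incompatible with a product at most `1/6`. -/
theorem uncovered_trans (hP : CliqueGram G P)
    (hx : OnlyTwo P x s t) (hy : OnlyTwo P y s' t') {a b : Finset V}
    (hz : OnlyTwo P z a b) (hxy : Uncovered G P x y) (hxz : Uncovered G P x z) (hyz : y ≠ z) :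
    Uncovered G P y z := by
  by_contra hcon
  have k := hP.form_res_le_of_not_uncovered hyz hy hz hcon
  obtain ⟨h1, h2, h12, hxs, hxt, hx⟩ := hx
  obtain ⟨h3, h4, h34, hys, hyt, hy⟩ := hy
  obtain ⟨h5, h6, h56, hzs, hzt, hz⟩ := hz
  have k1 := hP.le_form_res hxy.1 h1 h2 h3 h4 (hxy.2 s h1 hxs) (hxy.2 t h2 hxt)
    (fun h => hxy.2 s' h3 h hys) (fun h => hxy.2 t' h4 h hyt)
  have k2 := hP.le_form_res hxz.1 h1 h2 h5 h6 (hxz.2 s h1 hxs) (hxz.2 t h2 hxt)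
    (fun h => hxz.2 a h5 h hzs) (fun h => hxz.2 b h6 h hzt)
  have k3 := hP.form_res_self_le ⟨h1, hxs⟩ ⟨h2, hxt⟩ h12
  have k4 := hP.form_res_self_le ⟨h3, hys⟩ ⟨h4, hyt⟩ h34
  have k5 := hP.form_res_self_le ⟨h5, hzs⟩ ⟨h6, hzt⟩ h56
  have key := hP.psd ((2 : ℝ) • res x s t - res y s' t' - res z a b)
  simp only [map_sub, map_smul, LinearMap.sub_apply, LinearMap.smul_apply, smul_eq_mul,
    form_comm (res y s' t') (res x s t), form_comm (res z a b) (res x s t),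
    form_comm (res z a b) (res y s' t')] at key
  linarith

/-- The residuals of the twins nearly cancel, so that of `z` cannot have product about 1 with one
and product not much below 0 with the other, whether or not `y` and `z` are adjacent. -/
theorem twin_not_uncovered (hP : CliqueGram G P)
    (hxy : x ≠ y) (h1 : P s) (h2 : P t) (h12 : s ≠ t) (hxs : x ∈ s)
    (hxt : x ∈ t) (hys : y ∈ s) (hyt : y ∈ t) {a b : Finset V} (hz : OnlyTwo P z a b)
    (hxz : Uncovered G P x z) : False := by
  obtain ⟨h5, h6, h56, hzs, hzt, hz⟩ := hz
  have hs := hxz.2 s h1 hxs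
  have ht := hxz.2 t h2 hxt
  have ha : x ∉ a := fun h => hxz.2 a h5 h hzs
  have hb : x ∉ b := fun h => hxz.2 b h6 h hzt
  -- Otherwise `y` lies in three members of `P`, two of which contain `x`.
  have hya : y ∉ a := fun h => hP.not_mem_two_of_triple ⟨h1, hys⟩ ⟨h2, hyt⟩ ⟨h5, h⟩ h12
    (fun e => hs (e ▸ hzs)) (fun e => ht (e ▸ hzs)) hxy.symm hxs hxt
  have hyb : y ∉ b := fun h => hP.not_mem_two_of_triple ⟨h1, hys⟩ ⟨h2, hyt⟩ ⟨h6, h⟩ h12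
    (fun e => hs (e ▸ hzt)) (fun e => ht (e ▸ hzt)) hxy.symm hxs hxt
  have hyz : 0 ≤ form G (vtx y) (vtx z) := by
    rw [form_vtx_vtx]
    positivity
  have key := hP.psd (res x s t + res y s t - res z a b)
  simp only [map_add, map_sub, LinearMap.add_apply, LinearMap.sub_apply,
    form_comm (res y s t) (res x s t), form_comm (res z a b) (res x s t),
    form_comm (res z a b) (res y s t)] at key
  simp only [form_res_res x x, form_res_res x y, form_res_res y y, form_res_res x z,
    form_res_res y z, form_vtx_self, form_vtx_of_adj hxz.1, form_comm (avg t) (avg s),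
    hP.mem s h1 x hxs, hP.mem t h2 x hxt, hP.mem s h1 y hys, hP.mem t h2 y hyt] at key
  linarith [hP.form_res_self_le ⟨h5, hzs⟩ ⟨h6, hzt⟩ h56, form_vtx_vtx_le (G := G) hxy,
    hP.ne s h1 t h2 h12, hP.one_le s h1, hP.one_le t h2,
    hP.notMem a h5 x ha, hP.notMem b h6 x hb, hP.notMem a h5 y hya, hP.notMem b h6 y hyb,
    hP.notMem s h1 z hs, hP.notMem t h2 z ht,
    form_avg_nonneg (G := G) s a, form_avg_nonneg (G := G) s b,
    form_avg_nonneg (G := G) t a, form_avg_nonneg (G := G) t b]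

/-- Three nearly unit vectors cannot be pairwise nearly opposite. -/
theorem twin_unique (hP : CliqueGram G P)
    (hxy : x ≠ y) (hxz : x ≠ z) (hyz : y ≠ z) (h1 : P s) (h2 : P t)
    (h12 : s ≠ t) (hxs : x ∈ s) (hxt : x ∈ t) (hys : y ∈ s) (hyt : y ∈ t) (hzs : z ∈ s)
    (hzt : z ∈ t) : False := by
  have key := hP.psd (res x s t + res y s t + res z s t)
  simp only [map_add, LinearMap.add_apply, form_comm (res y s t) (res x s t),
    form_comm (res z s t) (res x s t), form_comm (res z s t) (res y s t)] at key
  linarith [hP.form_res_twin_le hxy h1 h2 h12 hxs hxt hys hyt,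
    hP.form_res_twin_le hxz h1 h2 h12 hxs hxt hzs hzt,
    hP.form_res_twin_le hyz h1 h2 h12 hys hyt hzs hzt,
    hP.form_res_self_le ⟨h1, hxs⟩ ⟨h2, hxt⟩ h12, hP.form_res_self_le ⟨h1, hys⟩ ⟨h2, hyt⟩ h12,
    hP.form_res_self_le ⟨h1, hzs⟩ ⟨h2, hzt⟩ h12]

end CliqueGram

end GramForm

/-! ### Completing the big cliques to a cover of all edges -/

namespace GramForm

/-- A family `Q` of cliques covering every edge exactly once, except that the edges of a matching
`T` lie in exactly the same cliques as their ends, such that the vertices on these edges are in at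
most two cliques, and all others in at most three. -/
structure CliqueCover {V : Type u} (G : SimpleGraph V) (Q : Finset V → Prop)
    (T : V → V → Prop) : Prop where
  nonempty : ∀ C, Q C → C.Nonempty
  clique : ∀ C, Q C → G.IsClique (C : Set V)
  ncard_le : ∀ x, {C | Q C ∧ x ∈ C}.ncard ≤ 3
  adj : ∀ x y, G.Adj x y → T x y ∨ ∃ C, Q C ∧ x ∈ C ∧ y ∈ C ∧ ∀ D, Q D → x ∈ D → y ∈ D → D = C
  twin_symm : ∀ x y, T x y → T y x
  twin_adj : ∀ x y, T x y → G.Adj x y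
  twin_mem : ∀ x y, T x y → ∀ C, Q C → x ∈ C → y ∈ C
  twin_ncard_le : ∀ x y, T x y → {C | Q C ∧ x ∈ C}.ncard ≤ 2
  twin_unique : ∀ x y z, T x y → T x z → y = z

/-- Two vertices in two common members of `P`. -/
def Twin {V : Type u} (P : Finset V → Prop) (x y : V) : Prop :=
  x ≠ y ∧ ∃ s t, P s ∧ P t ∧ s ≠ t ∧ x ∈ s ∧ x ∈ t ∧ y ∈ s ∧ y ∈ t

theorem Uncovered.symm {V : Type u} {G : SimpleGraph V} {P : Finset V → Prop} {x y : V}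
    (h : Uncovered G P x y) :
    Uncovered G P y x :=
  ⟨h.1.symm, fun s hs hy hx => h.2 s hs hx hy⟩

theorem Twin.symm {V : Type u} {P : Finset V → Prop} {x y : V} (h : Twin P x y) :
    Twin P y x := by
  obtain ⟨hne, s, t, h1, h2, h3, h4, h5, h6, h7⟩ := h
  exact ⟨hne.symm, s, t, h1, h2, h3, h6, h7, h4, h5⟩

variable {V : Type u} [Fintype V] [DecidableEq V] {G : SimpleGraph V}

open Classical in
/-- A vertex together with the vertices joined to it by uncovered edges. -/
noncomputable def uncoveredNhd (G : SimpleGraph V) (P : Finset V → Prop) (x : V) : Finset V :=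
  Finset.univ.filter fun z => z = x ∨ Uncovered G P x z

/-- The members of `P`, and the cliques formed by the uncovered edges. -/
def Extended (G : SimpleGraph V) (P : Finset V → Prop) (C : Finset V) : Prop :=
  P C ∨ ∃ x y, Uncovered G P x y ∧ C = uncoveredNhd G P x

theorem mem_uncoveredNhd {P : Finset V → Prop} {x z : V} :
    z ∈ uncoveredNhd G P x ↔ z = x ∨ Uncovered G P x z := by
  simp [uncoveredNhd]

variable [DecidableRel G.Adj]

namespace CliqueGram

variable {P : Finset V → Prop} {x y z : V}

/-- A third member of `P` at `x` would leave no edge at `x` uncovered, by `mem_of_triple`. -/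
theorem onlyTwo_of_uncovered (hP : CliqueGram G P)
    (h2 : ∀ x, ∃ s t, P s ∧ P t ∧ s ≠ t ∧ x ∈ s ∧ x ∈ t) (h : Uncovered G P x y) :
    ∃ s t, OnlyTwo P x s t := by
  obtain ⟨s, t, hs, ht, hst, hxs, hxt⟩ := h2 x
  refine ⟨s, t, hs, ht, hst, hxs, hxt, fun r hr hxr => ?_⟩
  by_contra! hcon
  rcases hP.mem_of_triple ⟨hs, hxs⟩ ⟨ht, hxt⟩ ⟨hr, hxr⟩ hst hcon.1.symm hcon.2.symm h.1
    with hy | hy | hy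
  · exact h.2 s hs hxs hy
  · exact h.2 t ht hxt hy
  · exact h.2 r hr hxr hy

theorem onlyTwo_of_twin (hP : CliqueGram G P) (h : Twin P x y) :
    ∃ s t, OnlyTwo P x s t ∧ OnlyTwo P y s t := by
  obtain ⟨hne, s, t, hs, ht, hst, hxs, hxt, hys, hyt⟩ := h
  refine ⟨s, t, ⟨hs, ht, hst, hxs, hxt, fun r hr hxr => ?_⟩,
    ⟨hs, ht, hst, hys, hyt, fun r hr hyr => ?_⟩⟩
  · by_contra! hcon
    exact hP.not_mem_two_of_triple ⟨hs, hxs⟩ ⟨ht, hxt⟩ ⟨hr, hxr⟩ hst hcon.1.symm hcon.2.symm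
      hne hys hyt
  · by_contra! hcon
    exact hP.not_mem_two_of_triple ⟨hs, hys⟩ ⟨ht, hyt⟩ ⟨hr, hyr⟩ hst hcon.1.symm hcon.2.symm
      hne.symm hxs hxt

theorem uncovered_trans' (hP : CliqueGram G P)
    (h2 : ∀ x, ∃ s t, P s ∧ P t ∧ s ≠ t ∧ x ∈ s ∧ x ∈ t) (hxy : Uncovered G P x y)
    (hxz : Uncovered G P x z) (hyz : y ≠ z) : Uncovered G P y z := by
  obtain ⟨s, t, hx⟩ := hP.onlyTwo_of_uncovered h2 hxy
  obtain ⟨s', t', hy⟩ := hP.onlyTwo_of_uncovered h2 hxy.symm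
  obtain ⟨a, b, hz⟩ := hP.onlyTwo_of_uncovered h2 hxz.symm
  exact hP.uncovered_trans hx hy hz hxy hxz hyz

theorem uncovered_of_mem_nhd (hP : CliqueGram G P)
    (h2 : ∀ x, ∃ s t, P s ∧ P t ∧ s ≠ t ∧ x ∈ s ∧ x ∈ t) (hy : y ∈ uncoveredNhd G P x)
    (hz : z ∈ uncoveredNhd G P x) (hyz : y ≠ z) : Uncovered G P y z := by
  rw [mem_uncoveredNhd] at hy hz
  rcases hy with rfl | hy
  · rcases hz with rfl | hz
    · exact absurd rfl hyz
    · exact hz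
  · rcases hz with rfl | hz
    · exact hy.symm
    · exact hP.uncovered_trans' h2 hy hz hyz

/-- Equality or an uncovered edge is an equivalence relation, and these sets are its classes. -/
theorem uncoveredNhd_eq (hP : CliqueGram G P)
    (h2 : ∀ x, ∃ s t, P s ∧ P t ∧ s ≠ t ∧ x ∈ s ∧ x ∈ t) (hy : y ∈ uncoveredNhd G P x) :
    uncoveredNhd G P x = uncoveredNhd G P y := by
  have hx : x ∈ uncoveredNhd G P y := by
    rw [mem_uncoveredNhd] at hy ⊢
    rcases hy with rfl | hy
    · exact Or.inl rfl
    · exact Or.inr hy.symm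
  ext z
  rw [mem_uncoveredNhd (x := y), mem_uncoveredNhd (x := x)]
  constructor
  · intro hz
    by_cases hzy : z = y
    · exact Or.inl hzy
    · exact Or.inr (hP.uncovered_of_mem_nhd h2 hy (mem_uncoveredNhd.mpr hz) (Ne.symm hzy))
  · intro hz
    by_cases hzx : z = x
    · exact Or.inl hzx
    · exact Or.inr (hP.uncovered_of_mem_nhd h2 hx (mem_uncoveredNhd.mpr hz) (Ne.symm hzx))

/-- A clique of uncovered edges through `x` is determined by `x`. -/
theorem eq_uncoveredNhd (hP : CliqueGram G P)
    (h2 : ∀ x, ∃ s t, P s ∧ P t ∧ s ≠ t ∧ x ∈ s ∧ x ∈ t) {C : Finset V} (hC : Extended G P C)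
    (hPC : ¬ P C) (hx : x ∈ C) : C = uncoveredNhd G P x ∧ ∃ y, Uncovered G P x y := by
  obtain hC | ⟨a, b, hab, rfl⟩ := hC
  · exact absurd hC hPC
  refine ⟨hP.uncoveredNhd_eq h2 hx, ?_⟩
  rw [mem_uncoveredNhd] at hx
  rcases hx with rfl | hx
  · exact ⟨b, hab⟩
  · exact ⟨a, hx.symm⟩

theorem not_twin_of_uncovered (hP : CliqueGram G P)
    (h2 : ∀ x, ∃ s t, P s ∧ P t ∧ s ≠ t ∧ x ∈ s ∧ x ∈ t) (hxy : Twin P x y) :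
    ¬ Uncovered G P x z := by
  intro h
  obtain ⟨a, b, hz⟩ := hP.onlyTwo_of_uncovered h2 h.symm
  obtain ⟨hne, s, t, hs, ht, hst, hxs, hxt, hys, hyt⟩ := hxy
  exact hP.twin_not_uncovered hne hs ht hst hxs hxt hys hyt hz h

/-- An added clique through `x` would supply an uncovered edge at a twin. -/
theorem prop_of_twin (hP : CliqueGram G P)
    (h2 : ∀ x, ∃ s t, P s ∧ P t ∧ s ≠ t ∧ x ∈ s ∧ x ∈ t) (hxy : Twin P x y) {C : Finset V}
    (hC : Extended G P C) (hx : x ∈ C) : P C := by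
  by_contra hPC
  obtain ⟨-, z, hz⟩ := hP.eq_uncoveredNhd h2 hC hPC hx
  exact hP.not_twin_of_uncovered h2 hxy hz

theorem ncard_le_three (hP : CliqueGram G P) (x : V) : {C | P C ∧ x ∈ C}.ncard ≤ 3 := by
  by_contra! hcon
  obtain ⟨S, hS, hS4⟩ := Set.exists_subset_card_eq (s := {C | P C ∧ x ∈ C}) (n := 4) hcon
  obtain ⟨a, S', ha, rfl, hS3⟩ := (Set.ncard_eq_succ (Set.toFinite S)).mp hS4
  obtain ⟨b, c, d, hbc, hbd, hcd, rfl⟩ := Set.ncard_eq_three.mp hS3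
  simp only [Set.mem_insert_iff, Set.mem_singleton_iff, not_or] at ha
  exact hP.not_four (hS (by simp)) (hS (by simp)) (hS (by simp)) (hS (by simp))
    ha.1 ha.2.1 ha.2.2 hbc hbd hcd

theorem cliqueCover (hP : CliqueGram G P) (hne : ∀ C, P C → C.Nonempty)
    (h2 : ∀ x, ∃ s t, P s ∧ P t ∧ s ≠ t ∧ x ∈ s ∧ x ∈ t) :
    CliqueCover G (Extended G P) (Twin P) where
  nonempty := by
    rintro C (hC | ⟨x, y, -, rfl⟩)
    · exact hne C hC
    · exact ⟨x, mem_uncoveredNhd.mpr (Or.inl rfl)⟩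
  clique := by
    rintro C (hC | ⟨x, y, -, rfl⟩)
    · exact hP.clique C hC
    · intro a ha b hb hab
      exact (hP.uncovered_of_mem_nhd h2 (by simpa using ha) (by simpa using hb) hab).1
  ncard_le := by
    intro x
    by_cases h : ∃ y, Uncovered G P x y
    · obtain ⟨y, hy⟩ := h
      obtain ⟨s, t, hx⟩ := hP.onlyTwo_of_uncovered h2 hy
      have hsub : {C | Extended G P C ∧ x ∈ C} ⊆ {s, t, uncoveredNhd G P x} := by
        rintro C ⟨hC, hxC⟩
        by_cases hPC : P C
        · rcases hx.2.2.2.2.2 C hPC hxC with rfl | rfl <;> simp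
        · simp [← (hP.eq_uncoveredNhd h2 hC hPC hxC).1]
      refine (Set.ncard_le_ncard hsub (Set.toFinite _)).trans ?_
      refine (Set.ncard_insert_le _ _).trans ?_
      exact Nat.succ_le_succ ((Set.ncard_insert_le _ _).trans (by simp))
    · refine (Set.ncard_le_ncard ?_ (Set.toFinite _)).trans (hP.ncard_le_three x)
      rintro C ⟨hC, hxC⟩
      refine ⟨?_, hxC⟩
      by_contra hPC
      exact h (hP.eq_uncoveredNhd h2 hC hPC hxC).2
  adj := by
    intro x y hxy
    by_cases h : Uncovered G P x y
    · refine Or.inr ⟨uncoveredNhd G P x, Or.inr ⟨x, y, h, rfl⟩,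
        mem_uncoveredNhd.mpr (Or.inl rfl), mem_uncoveredNhd.mpr (Or.inr h), ?_⟩
      intro D hD hxD hyD
      exact (hP.eq_uncoveredNhd h2 hD (fun hPD => h.2 D hPD hxD hyD) hxD).1
    · obtain ⟨s, hs, hxs, hys⟩ : ∃ s, P s ∧ x ∈ s ∧ y ∈ s := by
        by_contra! hcon
        exact h ⟨hxy, hcon⟩
      by_cases hT : Twin P x y
      · exact Or.inl hT
      refine Or.inr ⟨s, Or.inl hs, hxs, hys, fun D hD hxD hyD => ?_⟩
      by_contra hDs
      by_cases hPD : P D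
      · exact hT ⟨hxy.ne, D, s, hPD, hs, hDs, hxD, hxs, hyD, hys⟩
      · have hD' := (hP.eq_uncoveredNhd h2 hD hPD hxD).1
        rw [hD'] at hyD
        rcases mem_uncoveredNhd.mp hyD with e | e
        · exact hxy.ne e.symm
        · exact h e
  twin_symm := fun x y h => h.symm
  twin_adj := by
    rintro x y ⟨hne, s, -, hs, -, -, hxs, -, hys, -⟩
    exact hP.clique s hs (by simpa using hxs) (by simpa using hys) hne
  twin_mem := by
    intro x y h C hC hxC
    obtain ⟨s, t, hx, hy⟩ := hP.onlyTwo_of_twin h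
    rcases hx.2.2.2.2.2 C (hP.prop_of_twin h2 h hC hxC) hxC with rfl | rfl
    · exact hy.2.2.2.1
    · exact hy.2.2.2.2.1
  twin_ncard_le := by
    intro x y h
    obtain ⟨s, t, hx, hy⟩ := hP.onlyTwo_of_twin h
    have hsub : {C | Extended G P C ∧ x ∈ C} ⊆ {s, t} := by
      rintro C ⟨hC, hxC⟩
      exact hx.2.2.2.2.2 C (hP.prop_of_twin h2 h hC hxC) hxC
    refine (Set.ncard_le_ncard hsub (Set.toFinite _)).trans ?_
    exact (Set.ncard_insert_le _ _).trans (by simp)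
  twin_unique := by
    intro x y z hxy hxz
    by_contra hyz
    obtain ⟨s, t, hx, hz⟩ := hP.onlyTwo_of_twin hxz
    obtain ⟨s', t', hx', hy'⟩ := hP.onlyTwo_of_twin hxy
    have hs' := hx'.2.2.2.2.2 s hx.1 hx.2.2.2.1
    have ht' := hx'.2.2.2.2.2 t hx.2.1 hx.2.2.2.2.1
    refine hP.twin_unique hxy.1 hxz.1 hyz hx.1 hx.2.1 hx.2.2.1 hx.2.2.2.1 hx.2.2.2.2.1
      ?_ ?_ hz.2.2.2.1 hz.2.2.2.2.1
    · rcases hs' with rfl | rfl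
      · exact hy'.2.2.2.1
      · exact hy'.2.2.2.2.1
    · rcases ht' with rfl | rfl
      · exact hy'.2.2.2.1
      · exact hy'.2.2.2.2.1

end CliqueGram

end GramForm

/-! ### Special matrices, decompositions and the Hoffman graph of a clique cover -/

namespace HoffmanGraph

theorem specialMatrix_apply {V : Type u} [Finite V] (h : HoffmanGraph V) (x y : h.slim)
    [Decidable (h.graph.Adj (x : V) y)] :
    h.specialMatrix x y = (if h.graph.Adj (x : V) y then 1 else 0) -
      (({f | f ∈ h.fat ∧ h.graph.Adj f x ∧ h.graph.Adj f y}.ncard : ℕ) : ℤ) := by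
  classical
  let : Fintype h.fat := Fintype.ofFinite _
  have hcard : {f | f ∈ h.fat ∧ h.graph.Adj f x ∧ h.graph.Adj f y}.ncard =
      (Finset.univ.filter fun f : h.fat => h.graph.Adj f x ∧ h.graph.Adj f y).card := by
    rw [← Set.ncard_coe_finset, ← Set.ncard_image_of_injective _ Subtype.val_injective]
    congr 1
    ext f
    rw [Set.mem_image]
    constructor
    · rintro ⟨hf, hx, hy⟩
      exact ⟨⟨f, hf⟩, by simp [hx, hy], rfl⟩
    · rintro ⟨g, hg, rfl⟩
      have := (Finset.mem_filter.mp (Finset.mem_coe.mp hg)).2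
      exact ⟨g.2, this.1, this.2⟩
  rw [hcard, specialMatrix, Matrix.sub_apply, Matrix.mul_apply, SimpleGraph.adjMatrix_apply]
  congr 1
  · exact if_congr Iff.rfl rfl rfl
  · rw [Finset.card_filter, Nat.cast_sum]
    refine Finset.sum_congr rfl fun f _ => ?_
    simp only [fatSlimMatrix, Matrix.transpose_apply, Matrix.of_apply]
    split_ifs <;> simp_all

theorem mem_of_slim_generated {V : Type u} (h : HoffmanGraph V) {W : Set V} (hW : W ⊆ h.slim)
    (x : (h.generated W hW).slim) : (x.1 : V) ∈ W := by
  rcases x.1.2 with hx | hx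
  · exact hx
  · exact absurd hx.1 x.2

/-- Every fat vertex counted by the entry has a neighbour in `W`, so none is lost. Diagonal blocks
are therefore automatic, and a decomposition only requires zeros off the blocks. -/
theorem specialMatrix_generated {V : Type u} [Finite V] (h : HoffmanGraph V) {W : Set V}
    (hW : W ⊆ h.slim) (x y : (h.generated W hW).slim) :
    (h.generated W hW).specialMatrix x y = h.specialMatrix ⟨x.1.1, x.2⟩ ⟨y.1.1, y.2⟩ := by
  classical
  rw [specialMatrix_apply, specialMatrix_apply]
  congr 2
  rw [← Set.ncard_image_of_injective _ Subtype.val_injective]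
  congr 1
  ext f
  simp only [Set.mem_image, Set.mem_ofPred_eq, Subtype.exists, exists_and_right, exists_eq_right]
  constructor
  · rintro ⟨hf, h1, h2, h3⟩
    exact ⟨h1, h2, h3⟩
  · rintro ⟨h1, h2, h3⟩
    exact ⟨Or.inr ⟨h1, x.1.1, h.mem_of_slim_generated hW x, h2⟩, h1, h2, h3⟩

/-- An equivalence relation such that the special matrix vanishes outside of it gives a
decomposition whose parts are its classes. -/
theorem exists_decomposition {V : Type u} [Finite V] (h : HoffmanGraph V) (R : Setoid V)
    (hR : ∀ x y : h.slim, ¬ R x y → h.specialMatrix x y = 0) :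
    ∃ (r : ℕ) (d : h.Decomposition r), ∀ i, ∃ x ∈ h.slim, d.part i = {y | y ∈ h.slim ∧ R x y} := by
  classical
  let S : Setoid h.slim := R.comap Subtype.val
  obtain ⟨r, ⟨e⟩⟩ := Finite.exists_equiv_fin (Quotient S)
  let part : Fin r → Set V := fun i => {y | ∃ hy : y ∈ h.slim, e (Quotient.mk S ⟨y, hy⟩) = i}
  have part_subset : ∀ i, part i ⊆ h.slim := fun i y hy => hy.1
  have rep : ∀ i, ∃ x ∈ h.slim, part i = {y | y ∈ h.slim ∧ R x y} := by
    intro i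
    obtain ⟨x, hx⟩ := Quotient.exists_rep (e.symm i)
    refine ⟨x, x.2, ?_⟩
    ext y
    constructor
    · rintro ⟨hy, hyi⟩
      refine ⟨hy, ?_⟩
      rw [← Equiv.eq_symm_apply, ← hx] at hyi
      exact R.symm (Quotient.exact (s := S) hyi)
    · rintro ⟨hy, hyx⟩
      refine ⟨hy, ?_⟩
      rw [← Equiv.eq_symm_apply, ← hx]
      exact Quotient.sound (s := S) (R.symm hyx)
  refine ⟨r, ⟨part, part_subset, ?_, ?_, ?_, ?_⟩, rep⟩
  · intro i
    obtain ⟨x, hx, hi⟩ := rep i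
    exact ⟨x, by rw [hi]; exact ⟨hx, R.refl x⟩⟩
  · intro i j hij
    rw [Set.disjoint_left]
    rintro x ⟨hx, hi⟩ ⟨hx', hj⟩
    exact hij (hi.symm.trans hj)
  · intro x hx
    exact ⟨_, hx, rfl⟩
  · ext ⟨i, x⟩ ⟨j, y⟩
    rw [Matrix.submatrix_apply, Matrix.blockDiagonal'_apply]
    split_ifs with hij
    · obtain rfl : i = j := hij
      rw [specialMatrix_generated]
      rfl
    · apply hR
      intro hxy
      obtain ⟨hx, hxi⟩ := h.mem_of_slim_generated (part_subset i) x
      obtain ⟨hy, hyj⟩ := h.mem_of_slim_generated (part_subset j) y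
      apply hij
      dsimp only
      rw [← hxi, ← hyj]
      exact congrArg e (Quotient.sound (s := S) hxy)

/-- Upper bounds on the numbers of slim and fat vertices suffice, because only an induced subgraph
of the join is wanted. -/
theorem nonempty_embedding_completeJoin {W : Type u} [Finite W] (g : HoffmanGraph W) {s t : ℕ}
    (hs : g.slim.ncard ≤ s + 1) (ht : g.fat.ncard ≤ t)
    (hss : ∀ x ∈ g.slim, ∀ y ∈ g.slim, x ≠ y → g.graph.Adj x y)
    (hsf : ∀ x ∈ g.slim, ∀ f ∈ g.fat, g.graph.Adj x f) :
    Nonempty (InducedEmbedding g (completeJoin s t)) := by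
  classical
  obtain ⟨a⟩ : Nonempty (g.slim ↪ Fin (s + 1)) := by
    let := Fintype.ofFinite g.slim
    refine Function.Embedding.nonempty_of_card_le ?_
    rwa [Fintype.card_fin, ← Nat.card_eq_fintype_card, Nat.card_coe_set_eq]
  obtain ⟨b⟩ : Nonempty (g.fat ↪ Fin t) := by
    let := Fintype.ofFinite g.fat
    refine Function.Embedding.nonempty_of_card_le ?_
    rwa [Fintype.card_fin, ← Nat.card_eq_fintype_card, Nat.card_coe_set_eq]
  let φ : W → Fin (s + 1) ⊕ Fin t := fun x =>
    if hx : x ∈ g.fat then Sum.inr (b ⟨x, hx⟩) else Sum.inl (a ⟨x, hx⟩)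
  have φ_fat : ∀ x (hx : x ∈ g.fat), φ x = Sum.inr (b ⟨x, hx⟩) := fun x hx => dif_pos hx
  have φ_slim : ∀ x (hx : x ∉ g.fat), φ x = Sum.inl (a ⟨x, hx⟩) := fun x hx => dif_neg hx
  have hinj : Function.Injective φ := by
    intro x y hxy
    by_cases hx : x ∈ g.fat <;> by_cases hy : y ∈ g.fat
    · rw [φ_fat x hx, φ_fat y hy] at hxy
      exact congrArg Subtype.val (b.injective (Sum.inr_injective hxy))
    · rw [φ_fat x hx, φ_slim y hy] at hxy
      simp at hxy
    · rw [φ_slim x hx, φ_fat y hy] at hxy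
      simp at hxy
    · rw [φ_slim x hx, φ_slim y hy] at hxy
      exact congrArg Subtype.val (a.injective (Sum.inl_injective hxy))
  refine ⟨⟨⟨⟨φ, hinj⟩, ?_⟩, ?_⟩⟩
  · intro x y
    change (φ x ≠ φ y ∧ ((φ x).isLeft = true ∨ (φ y).isLeft = true)) ↔ g.graph.Adj x y
    rw [hinj.ne_iff]
    by_cases hx : x ∈ g.fat <;> by_cases hy : y ∈ g.fat
    · have := g.fat_not_adj x hx y hy
      simp [φ_fat x hx, φ_fat y hy, this]
    · have := (hsf y hy x hx).symm
      simp [φ_fat x hx, φ_slim y hy, this, this.ne]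
    · have := hsf x hx y hy
      simp [φ_slim x hx, φ_fat y hy, this, this.ne]
    · simp only [φ_slim x hx, φ_slim y hy, Sum.isLeft_inl, or_self, and_true]
      exact ⟨hss x hx y hy, fun h => h.ne⟩
  · intro x
    change φ x ∈ Set.range Sum.inr ↔ x ∈ g.fat
    by_cases hx : x ∈ g.fat
    · simp [φ_fat x hx, hx]
    · simp [φ_slim x hx, hx]

theorem nonempty_embedding_generated {V : Type u} [Finite V] (h : HoffmanGraph V) {W : Set V}
    (hW : W ⊆ h.slim) {s t : ℕ} (hs : W.ncard ≤ s + 1)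
    (ht : {f | f ∈ h.fat ∧ ∃ w ∈ W, h.graph.Adj f w}.ncard ≤ t)
    (hss : ∀ x ∈ W, ∀ y ∈ W, x ≠ y → h.graph.Adj x y)
    (hsf : ∀ x ∈ W, ∀ y ∈ W, ∀ f ∈ h.fat, h.graph.Adj f x → h.graph.Adj f y) :
    Nonempty (InducedEmbedding (h.generated W hW) (completeJoin s t)) := by
  refine nonempty_embedding_completeJoin _ (le_trans ?_ hs) (le_trans ?_ ht) ?_ ?_
  · rw [← Set.ncard_image_of_injective _ Subtype.val_injective]
    refine Set.ncard_le_ncard ?_ (Set.toFinite _)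
    rintro _ ⟨x, hx, rfl⟩
    exact h.mem_of_slim_generated hW ⟨x, hx⟩
  · rw [← Set.ncard_image_of_injective _ Subtype.val_injective]
    refine Set.ncard_le_ncard ?_ (Set.toFinite _)
    rintro _ ⟨x, hx, rfl⟩
    exact x.2.resolve_left fun hxW => hW hxW hx
  · intro x hx y hy hxy
    exact hss x (h.mem_of_slim_generated hW ⟨x, hx⟩) y (h.mem_of_slim_generated hW ⟨y, hy⟩)
      fun e => hxy (Subtype.ext e)
  · intro x hx f hf
    obtain ⟨hf', w, hw, hwf⟩ := f.2.resolve_left fun hfW => hW hfW hf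
    exact (hsf w hw x (h.mem_of_slim_generated hW ⟨x, hx⟩) f hf hwf).symm

/-- The Hoffman graph with slim graph `G` and one fat vertex for each member of a family of
nonempty vertex sets, adjacent to the members of the set. -/
def ofFamily {V : Type u} (G : SimpleGraph V) (Q : Finset V → Prop)
    (hQ : ∀ C, Q C → C.Nonempty) : HoffmanGraph (V ⊕ {C : Finset V // Q C}) where
  graph :=
    { Adj := fun a b =>
        match a, b with
        | Sum.inl x, Sum.inl y => G.Adj x y
        | Sum.inl x, Sum.inr C => x ∈ C.1
        | Sum.inr C, Sum.inl x => x ∈ C.1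
        | Sum.inr _, Sum.inr _ => False
      symm := ⟨by
        rintro (x | C) (y | D) hxy
        · exact G.symm.symm _ _ hxy
        · exact hxy
        · exact hxy
        · exact hxy⟩
      loopless := ⟨by
        rintro (x | C) hx
        · exact G.loopless.irrefl x hx
        · exact hx⟩ }
  fat := Set.range Sum.inr
  fat_not_adj := by
    rintro _ ⟨C, rfl⟩ _ ⟨D, rfl⟩ hCD
    exact hCD
  exists_slim_adj := by
    rintro _ ⟨C, rfl⟩
    obtain ⟨x, hx⟩ := hQ C.1 C.2
    exact ⟨Sum.inl x, by simp, hx⟩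

theorem ncard_fat_ofFamily {V : Type u} (Q : Finset V → Prop) (p : Finset V → Prop) :
    {f | ∃ C : {C // Q C}, f = (Sum.inr C : V ⊕ {C : Finset V // Q C}) ∧ p C}.ncard =
      {C | Q C ∧ p C}.ncard := by
  have h1 : {f | ∃ C : {C // Q C}, f = (Sum.inr C : V ⊕ {C : Finset V // Q C}) ∧ p C} =
      Sum.inr '' {C : {C // Q C} | p C} := by
    ext f
    constructor
    · rintro ⟨C, rfl, hC⟩
      exact ⟨C, hC, rfl⟩
    · rintro ⟨C, hC, rfl⟩
      exact ⟨C, rfl, hC⟩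
  have h2 : {C | Q C ∧ p C} = Subtype.val '' {C : {C // Q C} | p C} := by
    ext C
    simp [and_comm]
  rw [h1, h2, Set.ncard_image_of_injective _ Sum.inr_injective,
    Set.ncard_image_of_injective _ Subtype.val_injective]

/-- The classes of a matching. -/
def matchingSetoid {V : Type u} {J : Type w} (T : V → V → Prop) (hs : ∀ x y, T x y → T y x)
    (hu : ∀ x y z, T x y → T x z → y = z) : Setoid (V ⊕ J) where
  r a b := a = b ∨ ∃ x y, a = Sum.inl x ∧ b = Sum.inl y ∧ T x y
  iseqv := by
    refine ⟨fun a => Or.inl rfl, ?_, ?_⟩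
    · rintro a b (rfl | ⟨x, y, rfl, rfl, h⟩)
      · exact Or.inl rfl
      · exact Or.inr ⟨y, x, rfl, rfl, hs x y h⟩
    · rintro a b c (rfl | ⟨x, y, rfl, rfl, h⟩) hbc
      · exact hbc
      · rcases hbc with rfl | ⟨y', z, hy', rfl, h'⟩
        · exact Or.inr ⟨x, y, rfl, rfl, h⟩
        · obtain rfl := Sum.inl_injective hy'
          exact Or.inl (congrArg Sum.inl (hu y x z (hs x y h) h'))

theorem ofFamily_decomposition {V : Type u} [Finite V] {G : SimpleGraph V} {Q : Finset V → Prop}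
    {T : V → V → Prop} (hQ : GramForm.CliqueCover G Q T) :
    ∃ (r : ℕ) (d : (ofFamily G Q hQ.nonempty).Decomposition r), ∀ i : Fin r,
      ∃ g ∈ ({⟨_, oneSlimThreeFat⟩, ⟨_, twoSlimTwoFat⟩} : Set ((W : Type) × HoffmanGraph W)),
        Nonempty (InducedEmbedding (d.block i) g.2) := by
  classical
  set h := ofFamily G Q hQ.nonempty with hh
  have hslim : ∀ a ∈ h.slim, ∃ x, a = Sum.inl x := by
    rintro (x | C) ha
    · exact ⟨x, rfl⟩
    · exact absurd ⟨C, rfl⟩ ha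
  obtain ⟨r, d, hd⟩ := h.exists_decomposition
    (matchingSetoid T hQ.twin_symm hQ.twin_unique) (by
      rintro ⟨a, ha⟩ ⟨b, hb⟩ hab
      obtain ⟨x, rfl⟩ := hslim a ha
      obtain ⟨y, rfl⟩ := hslim b hb
      have hxy : x ≠ y := fun e => hab (Or.inl (congrArg Sum.inl e))
      have hT : ¬ T x y := fun hT => hab (Or.inr ⟨x, y, rfl, rfl, hT⟩)
      have hset : {f | f ∈ h.fat ∧ h.graph.Adj f (Sum.inl x) ∧ h.graph.Adj f (Sum.inl y)} =
          {f | ∃ C : {C // Q C}, f = Sum.inr C ∧ (x ∈ C.1 ∧ y ∈ C.1)} := by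
        ext f
        constructor
        · rintro ⟨⟨C, rfl⟩, h1, h2⟩
          exact ⟨C, rfl, h1, h2⟩
        · rintro ⟨C, rfl, h1, h2⟩
          exact ⟨⟨C, rfl⟩, h1, h2⟩
      rw [specialMatrix_apply, hset, ncard_fat_ofFamily Q fun C => x ∈ C ∧ y ∈ C]
      -- Outside the matching the entry is `1 - 1` on an edge, which lies in exactly one clique, and
      -- `0 - 0` on a non-edge.
      by_cases hadj : G.Adj x y
      · obtain ⟨C, hC, hxC, hyC, hu⟩ := (hQ.adj x y hadj).resolve_left hT
        have e : {C | Q C ∧ x ∈ C ∧ y ∈ C} = {C} := by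
          ext D
          constructor
          · rintro ⟨h1, h2, h3⟩
            exact hu D h1 h2 h3
          · rintro rfl
            exact ⟨hC, hxC, hyC⟩
        rw [e, if_pos (show h.graph.Adj (Sum.inl x) (Sum.inl y) from hadj)]
        simp
      · have e : {C | Q C ∧ x ∈ C ∧ y ∈ C} = ∅ := by
          ext D
          simp only [Set.mem_ofPred_eq, Set.mem_empty_iff_false, iff_false]
          rintro ⟨h1, h2, h3⟩
          exact hadj (hQ.clique D h1 (by simpa using h2) (by simpa using h3) hxy)
        rw [e, if_neg (show ¬ h.graph.Adj (Sum.inl x) (Sum.inl y) from hadj)]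
        simp)
  refine ⟨r, d, fun i => ?_⟩
  obtain ⟨a, ha, hi⟩ := hd i
  obtain ⟨x, rfl⟩ := hslim a ha
  have hfatx : {f | f ∈ h.fat ∧ h.graph.Adj f (Sum.inl x)} =
      {f | ∃ C : {C // Q C}, f = Sum.inr C ∧ x ∈ C.1} := by
    ext f
    constructor
    · rintro ⟨⟨C, rfl⟩, h1⟩
      exact ⟨C, rfl, h1⟩
    · rintro ⟨C, rfl, h1⟩
      exact ⟨⟨C, rfl⟩, h1⟩
  -- A matched pair has the same fat neighbours at both ends and fits in `𝔨`; an unmatched vertex is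
  -- a part by itself and fits in `𝔥⁽³⁾`.
  by_cases hT : ∃ y, T x y
  · obtain ⟨y, hy⟩ := hT
    have hpart : d.part i = {Sum.inl x, Sum.inl y} := by
      rw [hi]
      ext b
      constructor
      · rintro ⟨hb, rfl | ⟨x', y', hx', rfl, h'⟩⟩
        · exact Or.inl rfl
        · obtain rfl := Sum.inl_injective hx'
          exact Or.inr (congrArg Sum.inl (hQ.twin_unique x y' y h' hy))
      · rintro (rfl | rfl)
        · exact ⟨ha, Or.inl rfl⟩
        · exact ⟨by simp [h, slim, ofFamily], Or.inr ⟨x, y, rfl, rfl, hy⟩⟩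
    have hmem : ∀ C : {C // Q C}, x ∈ C.1 ↔ y ∈ C.1 := fun C =>
      ⟨hQ.twin_mem x y hy C.1 C.2, hQ.twin_mem y x (hQ.twin_symm x y hy) C.1 C.2⟩
    refine ⟨_, Or.inr rfl, h.nonempty_embedding_generated (d.part_subset i) ?_ ?_ ?_ ?_⟩
    · rw [hpart]
      exact (Set.ncard_insert_le _ _).trans (by simp)
    · refine le_trans (Set.ncard_le_ncard (t := {f | f ∈ h.fat ∧ h.graph.Adj f (Sum.inl x)})
        ?_ (Set.toFinite _)) ?_
      · rintro _ ⟨⟨C, rfl⟩, b, hb, hadj⟩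
        rw [hpart] at hb
        refine ⟨⟨C, rfl⟩, ?_⟩
        rcases hb with rfl | rfl
        · exact hadj
        · exact (hmem C).2 hadj
      · rw [hfatx, ncard_fat_ofFamily Q fun C => x ∈ C]
        exact hQ.twin_ncard_le x y hy
    · rw [hpart]
      rintro _ (rfl | rfl) _ (rfl | rfl) hne
      · exact absurd rfl hne
      · exact hQ.twin_adj x y hy
      · exact (hQ.twin_adj x y hy).symm
      · exact absurd rfl hne
    · rw [hpart]
      rintro _ (rfl | rfl) _ (rfl | rfl) _ ⟨C, rfl⟩ hadj
      · exact hadj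
      · exact (hmem C).1 hadj
      · exact (hmem C).2 hadj
      · exact hadj
  · have hpart : d.part i = {Sum.inl x} := by
      rw [hi]
      ext b
      constructor
      · rintro ⟨hb, rfl | ⟨x', y', hx', rfl, h'⟩⟩
        · rfl
        · obtain rfl := Sum.inl_injective hx'
          exact absurd ⟨y', h'⟩ hT
      · rintro rfl
        exact ⟨ha, Or.inl rfl⟩
    refine ⟨_, Or.inl rfl, h.nonempty_embedding_generated (d.part_subset i) ?_ ?_ ?_ ?_⟩
    · rw [hpart]
      simp
    · rw [hpart]
      simp only [Set.mem_singleton_iff, exists_eq_left]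
      rw [hfatx, ncard_fat_ofFamily Q fun C => x ∈ C]
      exact hQ.ncard_le x
    · rw [hpart]
      rintro _ rfl _ rfl hne
      exact absurd rfl hne
    · rw [hpart]
      rintro _ rfl _ rfl _ - hadj
      exact hadj

end HoffmanGraph

/-! ### The main theorem -/

open GramForm HoffmanGraph in
theorem theorem1p3 {V : Type u} [Fintype V] [DecidableEq V] (G : SimpleGraph V)
    [DecidableRel G.Adj] (c ctilde q K : ℕ) (hc : 1 ≤ c)
    (hct : ctilde = min c 6)
    (hq : q = max (c + 5) (50 * ctilde + 16))
    (hK : K = max (36 * c + 400 * ctilde + 83) (44 * c - 5))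
    (hmu : IsMuBounded G c)
    (hclique : ∀ C : Finset V, G.IsClique (C : Set V) → ∀ x ∈ C, C.card + K ≤ G.degree x)
    (heig : SmallestEigenvalueGE G (-3)) :
    (associatedHoffmanGraph G q (by omega)).IsTFat 2 ∧
      (associatedHoffmanGraph G q (by omega)).IsLineHoffmanGraph
        {⟨_, HoffmanGraph.oneSlimThreeFat⟩, ⟨_, HoffmanGraph.twoSlimTwoFat⟩} := by
  have hq' : q = max (c + 5) (50 * min c 6 + 16) := by rw [hq, hct]
  have hK' : K = max (36 * c + 400 * min c 6 + 83) (44 * c - 5) := by rw [hK, hct]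
  have h2 : ∀ x, ∃ s t, IsBigClique G q s ∧ IsBigClique G q t ∧ s ≠ t ∧ x ∈ s ∧ x ∈ t :=
    exists_two_isBigClique hc hq' hK' hmu hclique heig
  have hne : ∀ C, IsBigClique G q C → C.Nonempty := fun C hC =>
    Finset.card_pos.mp (by have := hC.2; omega)
  have hcover := (cliqueGram_isBigClique hc hq' hmu heig).cliqueCover hne h2
  refine ⟨?_, ?_⟩
  · rintro (x | C) hx
    · obtain ⟨s, t, hs, ht, hst, hxs, hxt⟩ := h2 x
      rw [Nat.succ_le_iff, Set.one_lt_ncard (Set.toFinite _)]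
      exact ⟨Sum.inr ⟨s, hs⟩, ⟨⟨_, rfl⟩, hxs⟩, Sum.inr ⟨t, ht⟩, ⟨⟨_, rfl⟩, hxt⟩, fun h =>
        hst (congrArg Subtype.val (Sum.inr_injective h))⟩
    · exact absurd ⟨C, rfl⟩ hx
  -- Big cliques keep their fat vertices; the only new fat vertices are those of the cliques of
  -- uncovered edges.
  · refine ⟨V ⊕ {C : Finset V // Extended G (IsBigClique G q) C}, inferInstance,
      ofFamily G _ hcover.nonempty, ⟨⟨⟨Sum.map id fun C => ⟨C.1, Or.inl C.2⟩, ?_⟩, ?_⟩, ?_⟩, ?_,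
      ofFamily_decomposition hcover⟩
    · refine Function.Injective.sumMap Function.injective_id fun C D h => ?_
      exact Subtype.ext (congrArg (fun E => E.1) h)
    · rintro (x | C) (y | D) <;> exact Iff.rfl
    · rintro (x | C)
      · exact iff_of_false (fun ⟨D, hD⟩ => Sum.inr_ne_inl hD) (fun ⟨D, hD⟩ => Sum.inr_ne_inl hD)
      · exact iff_of_true ⟨_, rfl⟩ ⟨C, rfl⟩
    · rintro (x | C) hx
      · exact ⟨Sum.inl x, rfl⟩
      · exact absurd ⟨C, rfl⟩ hx
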